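/- Let $\mathbb F$ be a field, $V$ an $\mathbb F$-vector space with a linearly ordered basis $\mathbb B$ (finite or infinite), and $p,t\in\mathbb F$ nonzero. **Structure.** For $a,b\in\mathbb B$ put $\theta_{a,b}=1$ if $a>b$ and $\theta_{a,b}=0$ otherwise, and let $\tau$ be the braiding of $V$ given by $\tau(a\otimes b)=(p^{\theta_{a,b}}-1)\,a\otimes b-p^{\theta_{b,a}}\,b\otimes a$. Let $\Lambda_p(V)$ be the exterior algebra of $V$ with its usual product $\nabla$ and unit, and with the braided Hopf algebra structure whose braiding $\hat\tau$ is induced by $\tau$ and in which all elements of $V$ are primitive; let $\Delta$ and $S$ be its coproduct and antipode. Let $\pi_k$ be the projection of $\Lambda_p(V)$ onto its degree-$k$ part $\Lambda_p^k(V)$, and for a finite $E\subseteq\mathbb B$ let $f_E$ be the product of the elements of $E$ in increasing order, and $f_{E,F}=f_E\otimes f_F$. Let $\phi_t$ be the automorphism of $\Lambda_p(V)$ that multiplies each vector of $V$ by $t$. Put $$\lambda_R=\nabla(\nabla\otimes\mathrm{id})\,(S\phi_t\otimes\mathrm{id}\otimes\mathrm{id})(\hat\tau\otimes\mathrm{id})(\mathrm{id}\otimes\Delta),\qquad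 \rho=(\phi_t\otimes\lambda_R)(\hat\tau\otimes\mathrm{id})(\mathrm{id}\otimes\Delta),$$ so that $\rho$ is an endomorphism of $\Lambda_p(V)\otimes\Lambda_p(V)$. For $k\ge 0$ put $$L_k=(\nabla\otimes\mathrm{id})(\mathrm{id}\otimes(\pi_k\otimes\mathrm{id})\Delta),\qquad R_k=(\mathrm{id}\otimes\nabla)((\mathrm{id}\otimes\pi_k)\Delta\otimes\mathrm{id}),\qquad L=L_1,\quad R=R_1 .$$ **Notation.** $(x;p)_n=\prod_{i=0}^{n-1}(1-xp^i)$, $[n]_p=\sum_{i=0}^{n-1}p^i$, $[n]_p^!=\prod_{i=1}^n[i]_p$, $y^{\langle n\rangle_p}=y^n/[n]_p^!$ (when $[n]_p^!\ne0$), and $W_n(x,y;p)=\sum_{i=0}^n (x;p)_{n-i}\,y^{\langle i\rangle_p}$. **Theorem.** 1. Let $E,F\subseteq\mathbb B$ be finite and suppose that $[j]_p\neq 0$ for $1\le j\le\max(|E|,|F|)$ (so that the divided powers below are defined). Then $$\rho f_{E,F}=\sum_{k=0}^{\min(|E|,|F|)}t^k(-1)^kp^{k(k-1)/2}\,W_{|F|-k}\big(tp^{|E|},tL;p\big)\,R^{\langle|E|-k\rangle_p}f_{E,F}.$$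 2. (MOY form; no condition on $p$ other than $p\ne0$.) For all integers $m,n\ge 0$ and $0\le i\le n$, $$(\pi_i\otimes\pi_{m+n-i})\,\rho\,(\pi_m\otimes\pi_n)=t^i(tp^m;p)_{n-i}\sum_{k=0}^{\min(i,m)}(-1)^kp^{k(k-1)/2}\,(\pi_i\otimes\pi_{m+n-i})\,L_{i-k}R_{m-k}\,(\pi_m\otimes\pi_n),$$ and all other components vanish: $(\pi_i\otimes\pi_j)\,\rho\,(\pi_m\otimes\pi_n)=0$ if $i>n$ or $i+j\ne m+n$. -/

import Mathlib

open scoped TensorProduct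

noncomputable section

namespace LambdaP

section Scalars

variable {F : Type*} [Field F]

/-- The `q`-Pochhammer symbol `(x;q)_n = ∏_{i<n} (1 - x q^i)`. -/
def qPoch (x q : F) (n : ℕ) : F := ∏ i ∈ Finset.range n, (1 - x * q ^ i)

/-- The `q`-integer `[n]_q = 1 + q + ⋯ + q^(n-1)`. -/
def qInt (q : F) (n : ℕ) : F := ∑ i ∈ Finset.range n, q ^ i

/-- The `q`-factorial `[n]_q! = [1]_q [2]_q ⋯ [n]_q`. -/
def qFact (q : F) (n : ℕ) : F := ∏ i ∈ Finset.Icc 1 n, qInt q i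

/-- The signed Gaussian exponential `(-1)^k p^(k(k-1)/2)`; note `k(k-1)/2 = k.choose 2`. -/
def gauss (p : F) (k : ℕ) : F := (-1) ^ k * p ^ (k.choose 2)

/-- The `q`-divided power `x^⟨n⟩ = x^n / [n]_q!` of an element of an algebra
(meaningful when `[n]_q! ≠ 0`). -/
def divPow {A : Type*} [Ring A] [Algebra F A] (q : F) (x : A) (n : ℕ) : A :=
  (qFact q n)⁻¹ • x ^ n

/-- `W_n(x,y;p) = ∑_{i=0}^n (x;p)_{n-i} y^⟨i⟩`, for a scalar `x` and an element `y` of an algebra. -/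
def W {A : Type*} [Ring A] [Algebra F A] (n : ℕ) (x : F) (y : A) (p : F) : A :=
  ∑ i ∈ Finset.range (n + 1), qPoch x p (n - i) • divPow p y i

end Scalars

variable {F V ι : Type*} [Field F] [AddCommGroup V] [Module F V] [LinearOrder ι]

local notation "Λ" => ExteriorAlgebra F V

/-- The Heaviside symbol `θ_{i,j}`: it is `1` if `i > j` and `0` otherwise. -/
def theta (i j : ι) : ℕ := if j < i then 1 else 0

/-- The braiding of `V` attached to a linearly ordered basis:
`τ(a ⊗ b) = (p^θ_{a,b} - 1) a ⊗ b - p^θ_{b,a} b ⊗ a` for basis vectors `a, b`. -/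
def tau (b : Module.Basis ι F V) (p : F) : V ⊗[F] V →ₗ[F] V ⊗[F] V :=
  (b.tensorProduct b).constr F fun ij =>
    (p ^ theta ij.1 ij.2 - 1) • (b ij.1 ⊗ₜ[F] b ij.2) -
      p ^ theta ij.2 ij.1 • (b ij.2 ⊗ₜ[F] b ij.1)

/-- Left multiplication in the exterior algebra by vectors, `v ⊗ x ↦ v x`. -/
def mulL : V ⊗[F] Λ →ₗ[F] Λ :=
  TensorProduct.lift (LinearMap.mul F Λ ∘ₗ ExteriorAlgebra.ι F)

/-- `v ⊗ (x ⊗ m) ↦ (v x) ⊗ m`. -/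
def push (M : Type*) [AddCommGroup M] [Module F M] : V ⊗[F] (Λ ⊗[F] M) →ₗ[F] Λ ⊗[F] M :=
  LinearMap.rTensor M mulL ∘ₗ (TensorProduct.assoc F V Λ M).symm.toLinearMap

/-- One step of the braiding of a vector through a word. If `g v` is the result of moving `v` to the
right through `y`, then `step b p w g v` is the result of moving `v` through `w y`: first `v` is
braided with `w` by `τ`, and then the outgoing strand is moved through `y`. -/
def step (b : Module.Basis ι F V) (p : F) :
    V →ₗ[F] Module.End F (V →ₗ[F] Λ ⊗[F] V) :=
  LinearMap.mk₂ F
    (fun w g => push V ∘ₗ LinearMap.lTensor V g ∘ₗ tau b p ∘ₗ (TensorProduct.mk F V V).flip w)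
    (fun w w' g => by ext v; simp)
    (fun c w g => by ext v; simp)
    (fun w g g' => by ext v; simp [LinearMap.lTensor_add])
    (fun c w g => by ext v; simp [LinearMap.lTensor_smul])

theorem step_apply (b : Module.Basis ι F V) (p : F) (w : V) (g : V →ₗ[F] Λ ⊗[F] V) (v : V) :
    step b p w g v = push V (LinearMap.lTensor V g (tau b p (v ⊗ₜ w))) := rfl

theorem push_tmul {M : Type*} [AddCommGroup M] [Module F M] (v : V) (x : Λ) (m : M) :
    push M (v ⊗ₜ[F] (x ⊗ₜ[F] m)) = (ExteriorAlgebra.ι F v * x) ⊗ₜ[F] m := by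
  simp [push, mulL]

theorem tau_basis (b : Module.Basis ι F V) (p : F) (i j : ι) :
    tau b p (b i ⊗ₜ b j) =
      (p ^ theta i j - 1) • (b i ⊗ₜ[F] b j) - p ^ theta j i • (b j ⊗ₜ[F] b i) := by
  have := (b.tensorProduct b).constr_basis F (fun ij : ι × ι =>
    (p ^ theta ij.1 ij.2 - 1) • (b ij.1 ⊗ₜ[F] b ij.2) -
      p ^ theta ij.2 ij.1 • (b ij.2 ⊗ₜ[F] b ij.1)) (i, j)
  rwa [Module.Basis.tensorProduct_apply] at this

theorem push_push {M : Type*} [AddCommGroup M] [Module F M] (v w : V) (x : Λ ⊗[F] M) :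
    push M (v ⊗ₜ push M (w ⊗ₜ x)) = - push M (w ⊗ₜ push M (v ⊗ₜ x)) := by
  induction x with
  | zero => simp
  | tmul x m =>
    simp only [push_tmul, ← mul_assoc]
    rw [eq_neg_of_add_eq_zero_left (ExteriorAlgebra.ι_add_mul_swap v w), neg_mul,
      TensorProduct.neg_tmul]
  | add x y hx hy => simp only [TensorProduct.tmul_add, map_add, hx, hy, neg_add]

theorem push_push_self {M : Type*} [AddCommGroup M] [Module F M] (v : V) (x : Λ ⊗[F] M) :
    push M (v ⊗ₜ push M (v ⊗ₜ x)) = 0 := by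
  induction x with
  | zero => simp
  | tmul x m =>
    simp only [push_tmul, ← mul_assoc, ExteriorAlgebra.ι_sq_zero, zero_mul, TensorProduct.zero_tmul]
  | add x y hx hy => simp only [TensorProduct.tmul_add, map_add, hx, hy, add_zero]

theorem step_basis (b : Module.Basis ι F V) (p : F) (i j : ι) (g : V →ₗ[F] Λ ⊗[F] V) :
    step b p (b j) g (b i) = (p ^ theta i j - 1) • push V (b i ⊗ₜ g (b j)) -
      p ^ theta j i • push V (b j ⊗ₜ g (b i)) := by
  rw [step_apply, tau_basis]
  simp

/-- A bilinear product on basis vectors that is alternating is alternating. -/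
theorem sq_zero_of_basis {A : Type*} [Semiring A] [Algebra F A] (b : Module.Basis ι F V)
    (f : V →ₗ[F] A) (h0 : ∀ i, f (b i) * f (b i) = 0)
    (h1 : ∀ i j, i < j → f (b i) * f (b j) + f (b j) * f (b i) = 0) (v : V) : f v * f v = 0 := by
  have key : ∀ v w, f v * f w + f w * f v = 0 := by
    intro v w
    have : (LinearMap.mul F A).compl₁₂ f f + ((LinearMap.mul F A).compl₁₂ f f).flip = 0 := by
      refine b.ext fun i => b.ext fun j => ?_
      rcases lt_trichotomy i j with h | h | h
      · simpa using h1 i j h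
      · subst h; simp [h0]
      · simpa [add_comm] using h1 j i h
    simpa using LinearMap.congr_fun₂ this v w
  induction b.mem_span v using Submodule.span_induction with
  | mem x hx => obtain ⟨i, rfl⟩ := hx; exact h0 i
  | zero => simp
  | add x y _ _ hx hy =>
    rw [map_add, mul_add, add_mul, add_mul, hx, hy, zero_add, add_zero, add_comm]
    exact key x y
  | smul c x _ hx => rw [map_smul, smul_mul_smul_comm, hx, smul_zero]

theorem theta_of_lt {i j : ι} (h : i < j) : theta i j = 0 := by simp [theta, h.le]

theorem theta_of_gt {i j : ι} (h : i < j) : theta j i = 1 := by simp [theta, h]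

theorem theta_self (i : ι) : theta i i = 0 := by simp [theta]

theorem step_sq (b : Module.Basis ι F V) (p : F) (w : V) : step b p w * step b p w = 0 := by
  refine sq_zero_of_basis b (step b p) (fun j => ?_) (fun j k hjk => ?_) w
  · ext g : 1
    refine b.ext fun i => ?_
    simp only [Module.End.mul_apply, step_basis, map_sub, map_smul, TensorProduct.tmul_sub,
      TensorProduct.tmul_smul, push_push_self, LinearMap.zero_apply]
    rw [push_push (b i) (b j)]
    rcases lt_trichotomy i j with h | h | h
    · simp only [theta_of_lt h, theta_of_gt h, theta_self]
      module
    · subst h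
      simp only [theta_self, push_push_self]
      module
    · simp only [theta_of_lt h, theta_of_gt h, theta_self]
      module
  · ext g : 1
    refine b.ext fun i => ?_
    simp only [Module.End.mul_apply, step_basis, map_sub, map_smul, TensorProduct.tmul_sub,
      TensorProduct.tmul_smul, LinearMap.zero_apply, LinearMap.add_apply]
    rw [push_push (b k) (b j), push_push (b j) (b i), push_push (b k) (b i)]
    simp only [theta_of_lt hjk, theta_of_gt hjk]
    rcases lt_trichotomy i j with h | h | h <;> rcases lt_trichotomy i k with h' | h' | h'
    all_goals first
      | (exfalso; order)
      | (try subst h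
         try subst h'
         simp only [theta_of_lt, theta_of_gt, theta_self, push_push_self, *]
         module)

/-- The braiding of a vector with the exterior algebra, as the family of maps `v ↦ τ̂(v ⊗ y)`
indexed by `y`: it satisfies `τ̂(v ⊗ 1) = 1 ⊗ v`, and for `y = w y'` it first braids `v` with `w`
by `τ` and then moves the outgoing strand through `y'`. -/
def crossAux (b : Module.Basis ι F V) (p : F) : Λ →ₗ[F] V →ₗ[F] Λ ⊗[F] V :=
  LinearMap.applyₗ (TensorProduct.mk F Λ V 1) ∘ₗ
    (ExteriorAlgebra.lift F ⟨step b p, step_sq b p⟩).toLinearMap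

/-- The braiding `τ̂` restricted to a map `V ⊗ ΛV → ΛV ⊗ V`. -/
def crossV (b : Module.Basis ι F V) (p : F) : V ⊗[F] Λ →ₗ[F] Λ ⊗[F] V :=
  TensorProduct.lift (crossAux b p).flip

/-- Left multiplication by `1 ⊗ v` in the braided tensor product algebra `ΛV ⊗ ΛV`: on `z ⊗ y`
it moves `v` through `z` by the braiding and then multiplies `y` by the outgoing vector. -/
def mulRight (b : Module.Basis ι F V) (p : F) : V →ₗ[F] Module.End F (Λ ⊗[F] Λ) :=
  TensorProduct.curry (LinearMap.lTensor Λ mulL ∘ₗ (TensorProduct.assoc F Λ V Λ).toLinearMap ∘ₗ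
    LinearMap.rTensor Λ (crossV b p) ∘ₗ (TensorProduct.assoc F V Λ Λ).symm.toLinearMap)

/-- Left multiplication by `v ⊗ 1` on `ΛV ⊗ ΛV`. -/
def mulLeft : V →ₗ[F] Module.End F (Λ ⊗[F] Λ) :=
  TensorProduct.curry (push Λ)

theorem crossAux_one (b : Module.Basis ι F V) (p : F) (v : V) :
    crossAux b p 1 v = 1 ⊗ₜ v := by
  simp [crossAux]

theorem crossAux_ι_mul (b : Module.Basis ι F V) (p : F) (w : V) (y : Λ) :
    crossAux b p (ExteriorAlgebra.ι F w * y) = step b p w (crossAux b p y) := by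
  simp [crossAux]

theorem crossV_tmul (b : Module.Basis ι F V) (p : F) (v : V) (y : Λ) :
    crossV b p (v ⊗ₜ y) = crossAux b p y v := by
  simp [crossV]

/-- The braiding on the first two strands of `V ⊗ (V ⊗ V)`. -/
def tau12 (b : Module.Basis ι F V) (p : F) : V ⊗[F] (V ⊗[F] V) →ₗ[F] V ⊗[F] (V ⊗[F] V) :=
  (TensorProduct.assoc F V V V).toLinearMap ∘ₗ LinearMap.rTensor V (tau b p) ∘ₗ
    (TensorProduct.assoc F V V V).symm.toLinearMap

/-- The braiding on the last two strands of `V ⊗ (V ⊗ V)`. -/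
def tau23 (b : Module.Basis ι F V) (p : F) : V ⊗[F] (V ⊗[F] V) →ₗ[F] V ⊗[F] (V ⊗[F] V) :=
  LinearMap.lTensor V (tau b p)

theorem tau12_basis (b : Module.Basis ι F V) (p : F) (i j k : ι) :
    tau12 b p (b i ⊗ₜ (b j ⊗ₜ b k)) = (p ^ theta i j - 1) • (b i ⊗ₜ[F] (b j ⊗ₜ[F] b k)) -
      p ^ theta j i • (b j ⊗ₜ[F] (b i ⊗ₜ[F] b k)) := by
  simp [tau12, tau_basis, TensorProduct.sub_tmul, TensorProduct.smul_tmul']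

theorem tau23_basis (b : Module.Basis ι F V) (p : F) (i j k : ι) :
    tau23 b p (b i ⊗ₜ (b j ⊗ₜ b k)) = (p ^ theta j k - 1) • (b i ⊗ₜ[F] (b j ⊗ₜ[F] b k)) -
      p ^ theta k j • (b i ⊗ₜ[F] (b k ⊗ₜ[F] b j)) := by
  simp [tau23, tau_basis, TensorProduct.tmul_sub]

set_option linter.unusedSimpArgs false in
theorem yang_baxter (b : Module.Basis ι F V) (p : F) :
    tau12 b p ∘ₗ tau23 b p ∘ₗ tau12 b p = tau23 b p ∘ₗ tau12 b p ∘ₗ tau23 b p := by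
  refine TensorProduct.ext (b.ext fun i => TensorProduct.ext (b.ext fun j => b.ext fun k => ?_))
  simp only [LinearMap.comp_apply, TensorProduct.mk_apply, tau12_basis,
    tau23_basis, map_sub, map_smul, LinearMap.compr₂ₛₗ_apply]
  rcases lt_trichotomy i j with h | h | h <;> rcases lt_trichotomy i k with h' | h' | h' <;>
    rcases lt_trichotomy j k with h'' | h'' | h''
  all_goals first
    | (exfalso; order)
    | (try subst h
       try subst h'
       try subst h''
       simp only [theta_of_lt, theta_of_gt, theta_self, tau12_basis, tau23_basis, map_sub,
         map_smul, *]
       try module)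

/-- Moving `V ⊗ V` to the right through `y`. -/
def cross2 (b : Module.Basis ι F V) (p : F) (y : Λ) : V ⊗[F] V →ₗ[F] Λ ⊗[F] (V ⊗[F] V) :=
  (TensorProduct.assoc F Λ V V).toLinearMap ∘ₗ LinearMap.rTensor V (crossV b p) ∘ₗ
    (TensorProduct.assoc F V Λ V).symm.toLinearMap ∘ₗ LinearMap.lTensor V (crossAux b p y)

theorem cross2_one (b : Module.Basis ι F V) (p : F) (X : V ⊗[F] V) :
    cross2 b p 1 X = 1 ⊗ₜ X := by
  induction X with
  | zero => simp
  | tmul v w => simp [cross2, crossAux_one, crossV_tmul]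
  | add x y hx hy => rw [map_add, hx, hy, TensorProduct.tmul_add]

theorem assoc_push (v : V) (s : Λ ⊗[F] V) (m : V) :
    TensorProduct.assoc F Λ V V (push V (v ⊗ₜ s) ⊗ₜ m) =
      push (V ⊗[F] V) (v ⊗ₜ TensorProduct.assoc F Λ V V (s ⊗ₜ m)) := by
  induction s with
  | zero => simp
  | tmul x q => simp [push_tmul]
  | add x y hx hy => simp only [TensorProduct.tmul_add, TensorProduct.add_tmul, map_add, hx, hy]

theorem cross2_ι_mul (b : Module.Basis ι F V) (p : F) (u : V) (y : Λ) (X : V ⊗[F] V) :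
    cross2 b p (ExteriorAlgebra.ι F u * y) X = push (V ⊗[F] V) (LinearMap.lTensor V (cross2 b p y)
      (tau12 b p (tau23 b p (TensorProduct.assoc F V V V (X ⊗ₜ u))))) := by
  induction X with
  | zero => simp
  | add x y hx hy => simp only [TensorProduct.add_tmul, map_add, hx, hy]
  | tmul v w =>
    simp only [cross2, tau12, tau23, LinearMap.comp_apply, LinearEquiv.coe_coe,
      TensorProduct.assoc_tmul, LinearMap.lTensor_tmul, crossAux_ι_mul, step_apply]
    generalize tau b p (w ⊗ₜ u) = Y
    induction Y with
    | zero => simp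
    | add x y hx hy => simp only [TensorProduct.tmul_add, map_add, hx, hy]
    | tmul a x =>
      simp only [LinearMap.lTensor_tmul, TensorProduct.assoc_symm_tmul, LinearMap.rTensor_tmul]
      have h : ∀ (Z : V ⊗[F] V), (LinearMap.lTensor V ((TensorProduct.assoc F Λ V V).toLinearMap ∘ₗ
          LinearMap.rTensor V (crossV b p) ∘ₗ (TensorProduct.assoc F V Λ V).symm.toLinearMap ∘ₗ
          LinearMap.lTensor V (crossAux b p y))) (TensorProduct.assoc F V V V (Z ⊗ₜ x)) =
        LinearMap.lTensor V ((TensorProduct.assoc F Λ V V).toLinearMap ∘ₗ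
          LinearMap.rTensor V (crossV b p) ∘ₗ (TensorProduct.assoc F V Λ V).symm.toLinearMap)
          (TensorProduct.assoc F V V (Λ ⊗[F] V) (Z ⊗ₜ crossAux b p y x)) := by
        intro Z
        induction Z with
        | zero => simp
        | add x y hx hy => simp only [TensorProduct.add_tmul, map_add, hx, hy]
        | tmul c d => simp
      rw [h]
      generalize crossAux b p y x = S
      induction S with
      | zero => simp
      | add x y hx hy => simp only [TensorProduct.tmul_add, map_add, hx, hy]
      | tmul z m =>
        simp only [push_tmul, TensorProduct.assoc_symm_tmul, LinearMap.rTensor_tmul, crossV_tmul,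
          crossAux_ι_mul, step_apply]
        generalize tau b p (v ⊗ₜ a) = Z
        induction Z with
        | zero => simp
        | add x y hx hy => simp only [TensorProduct.add_tmul, map_add, hx, hy]
        | tmul c d => simp [assoc_push, crossV_tmul]

theorem lTensor_push (f : V ⊗[F] V →ₗ[F] V ⊗[F] V) (X : V ⊗[F] (Λ ⊗[F] (V ⊗[F] V))) :
    LinearMap.lTensor Λ f (push (V ⊗[F] V) X) =
      push (V ⊗[F] V) (LinearMap.lTensor V (LinearMap.lTensor Λ f) X) := by
  induction X with
  | zero => simp
  | add x y hx hy => simp only [map_add, hx, hy]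
  | tmul v s =>
    induction s with
    | zero => simp
    | add x y hx hy => simp only [TensorProduct.tmul_add, map_add, hx, hy]
    | tmul x m => simp [push_tmul]

theorem cross2_tau (b : Module.Basis ι F V) (p : F) (y : Λ) (X : V ⊗[F] V) :
    cross2 b p y (tau b p X) = LinearMap.lTensor Λ (tau b p) (cross2 b p y X) := by
  induction y using CliffordAlgebra.left_induction generalizing X with
  | algebraMap r =>
    rw [Algebra.algebraMap_eq_smul_one]
    have h : ∀ X, cross2 b p (r • (1 : Λ)) X = r • ((1 : Λ) ⊗ₜ[F] X) := by
      intro X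
      rw [← cross2_one b p]
      simp [cross2]
    simp [h]
  | add x y hx hy =>
    have h : ∀ X, cross2 b p (x + y) X = cross2 b p x X + cross2 b p y X := by
      intro X
      simp [cross2, LinearMap.lTensor_add]
    simp only [h, map_add, hx, hy]
  | ι_mul y u hy =>
    change ∀ X, cross2 b p y (tau b p X) = _ at hy
    change cross2 b p (ExteriorAlgebra.ι F u * y) _ =
      LinearMap.lTensor Λ _ (cross2 b p (ExteriorAlgebra.ι F u * y) _)
    have h1 : TensorProduct.assoc F V V V (tau b p X ⊗ₜ u) =
        tau12 b p (TensorProduct.assoc F V V V (X ⊗ₜ u)) := by simp [tau12]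
    have h2 : ∀ Z, LinearMap.lTensor V (cross2 b p y) (tau23 b p Z) =
        LinearMap.lTensor V (LinearMap.lTensor Λ (tau b p)) (LinearMap.lTensor V (cross2 b p y) Z) := by
      intro Z
      rw [tau23, ← LinearMap.comp_apply, ← LinearMap.lTensor_comp, ← LinearMap.comp_apply,
        ← LinearMap.lTensor_comp]
      congr 2
      ext1
      ext
      simp [hy]
    have h3 := LinearMap.congr_fun (yang_baxter b p) (TensorProduct.assoc F V V V (X ⊗ₜ u))
    simp only [LinearMap.comp_apply] at h3
    rw [cross2_ι_mul, cross2_ι_mul, lTensor_push, h1, h3, h2]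

/-- On `V ⊗ V` the product factors through `τ + 1`; this is the factoring map. -/
def halfMul (b : Module.Basis ι F V) : V ⊗[F] V →ₗ[F] Λ :=
  (b.tensorProduct b).constr F fun ij =>
    if ij.1 < ij.2 then ExteriorAlgebra.ι F (b ij.1) * ExteriorAlgebra.ι F (b ij.2) else 0

theorem halfMul_basis (b : Module.Basis ι F V) (i j : ι) : halfMul b (b i ⊗ₜ b j) =
    if i < j then ExteriorAlgebra.ι F (b i) * ExteriorAlgebra.ι F (b j) else 0 := by
  have := (b.tensorProduct b).constr_basis F (fun ij : ι × ι =>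
    if ij.1 < ij.2 then ExteriorAlgebra.ι F (b ij.1) * ExteriorAlgebra.ι F (b ij.2) else 0) (i, j)
  rwa [Module.Basis.tensorProduct_apply] at this

theorem halfMul_tau (b : Module.Basis ι F V) (p : F) :
    halfMul b ∘ₗ (tau b p + LinearMap.id) =
      mulL ∘ₗ LinearMap.lTensor V (ExteriorAlgebra.ι F) := by
  refine TensorProduct.ext (b.ext fun i => b.ext fun j => ?_)
  have h1 := ExteriorAlgebra.ι_add_mul_swap (R := F) (b i) (b j)
  rcases lt_trichotomy i j with h | h | h
  · simp [mulL, tau_basis, halfMul_basis, theta_of_lt, theta_of_gt, h, h.not_gt]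
  · subst h
    simp [mulL, tau_basis, theta_self]
  · simp [mulL, tau_basis, halfMul_basis, theta_of_lt, theta_of_gt, h, h.not_gt,
      eq_neg_of_add_eq_zero_left h1]

theorem tau_self (b : Module.Basis ι F V) (p : F) (v : V) : tau b p (v ⊗ₜ v) = -(v ⊗ₜ[F] v) := by
  have key : ∀ v w, tau b p (v ⊗ₜ w) + tau b p (w ⊗ₜ v) + v ⊗ₜ w + w ⊗ₜ v = 0 := by
    intro v w
    have : (tau b p + LinearMap.id) ∘ₗ (LinearMap.id + (TensorProduct.comm F V V).toLinearMap) =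
        0 := by
      refine TensorProduct.ext (b.ext fun i => b.ext fun j => ?_)
      rcases lt_trichotomy i j with h | h | h
      · simp [tau_basis, theta_of_lt, theta_of_gt, h]
        module
      · subst h
        simp [tau_basis, theta_self]
      · simp [tau_basis, theta_of_lt, theta_of_gt, h]
        module
    have := LinearMap.congr_fun this (v ⊗ₜ w)
    simp at this
    rw [← this]
    abel
  induction b.mem_span v using Submodule.span_induction with
  | mem x hx => obtain ⟨i, rfl⟩ := hx; simp [tau_basis, theta_self]
  | zero => simp
  | add x y _ _ hx hy =>
    have := key x y
    simp only [TensorProduct.add_tmul, TensorProduct.tmul_add, map_add, hx, hy]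
    rw [← sub_eq_zero] at this ⊢
    rw [← this]
    abel
  | smul c x _ hx =>
    simp only [TensorProduct.tmul_smul, TensorProduct.smul_tmul, map_smul, hx, smul_neg]

theorem cross2_self (b : Module.Basis ι F V) (p : F) (y : Λ) (v : V) :
    LinearMap.lTensor Λ (mulL ∘ₗ LinearMap.lTensor V (ExteriorAlgebra.ι F))
      (cross2 b p y (v ⊗ₜ v)) = 0 := by
  rw [← halfMul_tau b p, LinearMap.lTensor_comp, LinearMap.comp_apply, LinearMap.lTensor_add,
    LinearMap.add_apply, ← cross2_tau, tau_self]
  simp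

theorem mulRight_tmul (b : Module.Basis ι F V) (p : F) (v : V) (z y : Λ) :
    mulRight b p v (z ⊗ₜ y) = LinearMap.lTensor Λ mulL
      (TensorProduct.assoc F Λ V Λ (crossAux b p z v ⊗ₜ y)) := by
  simp [mulRight, crossV_tmul]

theorem mulL_tmul (v : V) (y : Λ) : mulL (v ⊗ₜ[F] y) = ExteriorAlgebra.ι F v * y := by
  simp [mulL]

theorem mulRight_sq (b : Module.Basis ι F V) (p : F) (v : V) :
    mulRight b p v * mulRight b p v = 0 := by
  refine TensorProduct.ext' fun z y => ?_
  have h : ∀ X : Λ ⊗[F] V, mulRight b p v (LinearMap.lTensor Λ mulL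
      (TensorProduct.assoc F Λ V Λ (X ⊗ₜ y))) =
      LinearMap.lTensor Λ (LinearMap.mulRight F y)
      (LinearMap.lTensor Λ (mulL ∘ₗ LinearMap.lTensor V (ExteriorAlgebra.ι F))
      (TensorProduct.assoc F Λ V V (LinearMap.rTensor V (crossV b p)
      ((TensorProduct.assoc F V Λ V).symm (v ⊗ₜ X))))) := by
    intro X
    induction X with
    | zero => simp
    | add x y hx hy => simp only [TensorProduct.tmul_add, TensorProduct.add_tmul, map_add, hx, hy]
    | tmul x w =>
      simp only [TensorProduct.assoc_tmul, LinearMap.lTensor_tmul, mulRight_tmul, mulL_tmul,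
        TensorProduct.assoc_symm_tmul, LinearMap.rTensor_tmul, crossV_tmul]
      generalize crossAux b p x v = S
      induction S with
      | zero => simp
      | add x y hx hy => simp only [TensorProduct.add_tmul, map_add, hx, hy]
      | tmul s q => simp [mulL_tmul, mul_assoc]
  rw [Module.End.mul_apply, mulRight_tmul, h]
  have := cross2_self b p z v
  simp only [cross2, LinearMap.comp_apply, LinearMap.lTensor_tmul, LinearEquiv.coe_coe] at this
  rw [this]
  simp

theorem mulLeft_apply (v : V) (X : Λ ⊗[F] Λ) : mulLeft v X = push Λ (v ⊗ₜ X) := rfl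

theorem coprod_sq (b : Module.Basis ι F V) (p : F) (v : V) :
    (mulLeft (F := F) (V := V) + mulRight b p) v * (mulLeft (F := F) (V := V) + mulRight b p) v = 0 := by
  have h : mulLeft v * mulRight b p v + mulRight b p v * mulLeft v = 0 := by
    refine TensorProduct.ext' fun z y => ?_
    have h' : tau b p (v ⊗ₜ v) = (-1 : F) • (v ⊗ₜ[F] v) := by rw [tau_self, neg_one_smul]
    simp only [LinearMap.add_apply, Module.End.mul_apply, mulLeft_apply, push_tmul, mulRight_tmul,
      crossAux_ι_mul, step_apply, h', LinearMap.zero_apply, map_smul, LinearMap.lTensor_tmul]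
    generalize crossAux b p z v = S
    induction S with
    | zero => simp
    | add x y hx hy =>
      simp only [TensorProduct.tmul_add, TensorProduct.add_tmul, map_add, smul_add] at hx hy ⊢
      rw [add_add_add_comm, hx, hy, add_zero]
    | tmul s q =>
      rw [push_tmul, TensorProduct.smul_tmul', TensorProduct.assoc_tmul,
        TensorProduct.assoc_tmul, LinearMap.lTensor_tmul, LinearMap.lTensor_tmul, push_tmul,
        ← TensorProduct.smul_tmul', neg_one_smul, add_neg_cancel]
  have h0 : mulLeft (F := F) v * mulLeft v = 0 := by
    refine LinearMap.ext fun X => ?_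
    exact push_push_self v X
  rw [LinearMap.add_apply, mul_add, add_mul, add_mul, h0, mulRight_sq, zero_add, add_zero, add_comm]
  exact h

/-- Multiplication on the right by vectors, `x ⊗ v ↦ x v`. -/
def mulR : Λ ⊗[F] V →ₗ[F] Λ :=
  LinearMap.mul' F Λ ∘ₗ LinearMap.lTensor Λ (ExteriorAlgebra.ι F)

/-- The operators `y ↦ -∇ τ̂(v ⊗ y)`. -/
def antiStep (b : Module.Basis ι F V) (p : F) : V →ₗ[F] Module.End F Λ :=
  -TensorProduct.curry (mulR ∘ₗ crossV b p)

/-- Moving a strand `v'` through a vector `w` by `τ` and absorbing the vectors that leave to the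
left into the algebra: `y ⊗ v' ↦ (y · - ⊗ id)(τ(v' ⊗ w))`. -/
def crossEnd (b : Module.Basis ι F V) (p : F) (w : V) : Λ ⊗[F] V →ₗ[F] Λ ⊗[F] V :=
  LinearMap.rTensor V mulR ∘ₗ (TensorProduct.assoc F Λ V V).symm.toLinearMap ∘ₗ
    LinearMap.lTensor Λ (tau b p ∘ₗ (TensorProduct.mk F V V).flip w)

theorem crossEnd_tmul (b : Module.Basis ι F V) (p : F) (w : V) (y : Λ) (v : V) :
    crossEnd b p w (y ⊗ₜ v) =
      LinearMap.rTensor V mulR ((TensorProduct.assoc F Λ V V).symm (y ⊗ₜ tau b p (v ⊗ₜ w))) := by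
  simp [crossEnd]

theorem mulR_tmul (y : Λ) (v : V) : mulR (y ⊗ₜ[F] v) = y * ExteriorAlgebra.ι F v := by
  simp [mulR]

theorem crossEnd_push (b : Module.Basis ι F V) (p : F) (w u : V) (X : Λ ⊗[F] V) :
    crossEnd b p w (push V (u ⊗ₜ X)) = push V (u ⊗ₜ crossEnd b p w X) := by
  induction X with
  | zero => simp
  | add x y hx hy => simp only [TensorProduct.tmul_add, map_add, hx, hy]
  | tmul y v =>
    rw [push_tmul, crossEnd_tmul, crossEnd_tmul]
    generalize tau b p (v ⊗ₜ w) = Y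
    induction Y with
    | zero => simp
    | add x y hx hy => simp only [TensorProduct.tmul_add, map_add, hx, hy]
    | tmul c d => simp [mulR_tmul, push_tmul, mul_assoc]

theorem crossAux_mul_ι (b : Module.Basis ι F V) (p : F) (y : Λ) (w v : V) :
    crossAux b p (y * ExteriorAlgebra.ι F w) v = crossEnd b p w (crossAux b p y v) := by
  induction y using CliffordAlgebra.left_induction generalizing v with
  | algebraMap r =>
    have h : crossAux b p (ExteriorAlgebra.ι F w) v = crossEnd b p w (1 ⊗ₜ v) := by
      have h1 := crossAux_ι_mul b p w 1
      rw [mul_one] at h1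
      rw [h1, step_apply, crossEnd_tmul]
      generalize tau b p (v ⊗ₜ w) = Y
      induction Y with
      | zero => simp
      | add x y hx hy => simp only [TensorProduct.tmul_add, map_add, hx, hy]
      | tmul c d => simp [mulR_tmul, push_tmul, crossAux_one]
    rw [Algebra.algebraMap_eq_smul_one, smul_mul_assoc, one_mul, map_smul, map_smul,
      LinearMap.smul_apply, LinearMap.smul_apply, h, crossAux_one, map_smul]
  | add x y hx hy => simp only [add_mul, map_add, LinearMap.add_apply, hx, hy]
  | ι_mul y u hy =>
    change crossAux b p (ExteriorAlgebra.ι F u * y * _) v =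
      crossEnd b p w (crossAux b p (ExteriorAlgebra.ι F u * y) v)
    rw [mul_assoc, crossAux_ι_mul, crossAux_ι_mul, step_apply, step_apply]
    generalize tau b p (v ⊗ₜ u) = Y
    induction Y with
    | zero => simp
    | add x y hx hy => simp only [map_add, hx, hy]
    | tmul c d => simp only [LinearMap.lTensor_tmul, crossEnd_push, hy]

theorem mul_tau (b : Module.Basis ι F V) (p : F) (X : V ⊗[F] V) :
    mulL (LinearMap.lTensor V (ExteriorAlgebra.ι F) (tau b p X)) =
      p • mulL (LinearMap.lTensor V (ExteriorAlgebra.ι F) X) := by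
  have : (mulL ∘ₗ LinearMap.lTensor V (ExteriorAlgebra.ι F)) ∘ₗ tau b p =
      p • (mulL ∘ₗ LinearMap.lTensor V (ExteriorAlgebra.ι F)) := by
    refine TensorProduct.ext (b.ext fun i => b.ext fun j => ?_)
    have h1 := ExteriorAlgebra.ι_add_mul_swap (R := F) (b i) (b j)
    have h2 := eq_neg_of_add_eq_zero_left h1
    rcases lt_trichotomy i j with h | h | h
    · simp [mulL_tmul, tau_basis, theta_of_lt, theta_of_gt, h, h2]
    · subst h
      simp [mulL_tmul, tau_basis, theta_self]
    · simp [mulL_tmul, tau_basis, theta_of_lt, theta_of_gt, h, h2]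
      module
  exact LinearMap.congr_fun this X

theorem antiStep_apply (b : Module.Basis ι F V) (p : F) (v : V) (y : Λ) :
    antiStep b p v y = -mulR (crossAux b p y v) := by
  simp [antiStep, crossV_tmul]

theorem antiStep_sq (b : Module.Basis ι F V) (p : F) (v : V) :
    antiStep b p v * antiStep b p v = 0 := by
  refine LinearMap.ext fun y => ?_
  have h : ∀ X : Λ ⊗[F] V, mulR (crossAux b p (mulR X) v) = p • LinearMap.mul' F Λ
      (LinearMap.lTensor Λ (mulL ∘ₗ LinearMap.lTensor V (ExteriorAlgebra.ι F))
      (TensorProduct.assoc F Λ V V (LinearMap.rTensor V (crossV b p)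
      ((TensorProduct.assoc F V Λ V).symm (v ⊗ₜ X))))) := by
    intro X
    induction X with
    | zero => simp
    | add x y hx hy =>
      simp only [TensorProduct.tmul_add, map_add, LinearMap.add_apply, hx, hy, smul_add]
    | tmul x w =>
      simp only [mulR_tmul, crossAux_mul_ι, TensorProduct.assoc_symm_tmul, LinearMap.rTensor_tmul,
        crossV_tmul]
      generalize crossAux b p x v = S
      induction S with
      | zero => simp
      | add x y hx hy => simp only [TensorProduct.add_tmul, map_add, hx, hy, smul_add]
      | tmul s q =>
        have h3 : ∀ Y : V ⊗[F] V, mulR (LinearMap.rTensor V mulR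
            ((TensorProduct.assoc F Λ V V).symm (s ⊗ₜ Y))) =
            s * mulL (LinearMap.lTensor V (ExteriorAlgebra.ι F) Y) := by
          intro Y
          induction Y with
          | zero => simp
          | add x y hx hy => simp only [TensorProduct.tmul_add, map_add, hx, hy, mul_add]
          | tmul c d => simp [mulR_tmul, mulL_tmul, mul_assoc]
        rw [crossEnd_tmul, h3, mul_tau]
        simp
  have := cross2_self b p y v
  simp only [cross2, LinearMap.comp_apply, LinearMap.lTensor_tmul, LinearEquiv.coe_coe] at this
  rw [Module.End.mul_apply, antiStep_apply, antiStep_apply, map_neg, LinearMap.neg_apply, map_neg,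
    neg_neg, h, this]
  simp

/-! The structure maps of `Λ_p(V)`: the exterior algebra of `V`, with its ordinary product,
the braiding induced by `τ`, and the braided Hopf structure in which vectors are primitive. -/

/-- The braiding `τ̂` of `Λ_p(V)`: the map with `τ̂(1 ⊗ z) = z ⊗ 1` and
`τ̂ (∇ ⊗ id) = (id ⊗ ∇)(τ̂ ⊗ id)(id ⊗ τ̂)` whose restriction to `V ⊗ ΛV` is `crossV`. -/
def tauHat (b : Module.Basis ι F V) (p : F) : Λ ⊗[F] Λ →ₗ[F] Λ ⊗[F] Λ :=
  TensorProduct.lift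
    ((LinearMap.lcomp F (Λ ⊗[F] Λ) ((TensorProduct.mk F Λ Λ).flip 1)) ∘ₗ
      (ExteriorAlgebra.lift F ⟨mulRight b p, mulRight_sq b p⟩).toLinearMap)

/-- The coproduct `Δ` of `Λ_p(V)`: the algebra map into the braided tensor product algebra
`ΛV ⊗ ΛV` with `Δ v = v ⊗ 1 + 1 ⊗ v` for vectors `v`. -/
def comul (b : Module.Basis ι F V) (p : F) : Λ →ₗ[F] Λ ⊗[F] Λ :=
  LinearMap.applyₗ ((1 : Λ) ⊗ₜ[F] (1 : Λ)) ∘ₗ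
    (ExteriorAlgebra.lift F ⟨mulLeft + mulRight b p, coprod_sq b p⟩).toLinearMap

/-- The antipode `S` of `Λ_p(V)`: the map with `S 1 = 1`, `S v = -v` for vectors `v`, and
`S ∇ = ∇ τ̂ (S ⊗ S)`. -/
def antipode (b : Module.Basis ι F V) (p : F) : Λ →ₗ[F] Λ :=
  LinearMap.applyₗ (1 : Λ) ∘ₗ
    (ExteriorAlgebra.lift F ⟨antiStep b p, antiStep_sq b p⟩).toLinearMap

/-- The product `∇`. -/
def nabla : Λ ⊗[F] Λ →ₗ[F] Λ := LinearMap.mul' F Λ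

/-- The projection `π_k` onto the elements of degree `k`. -/
def proj (k : ℕ) : Λ →ₗ[F] Λ := GradedAlgebra.proj (fun i : ℕ => ⋀[F]^i V) k

/-- The diagonal automorphism `φ_t`, which multiplies vectors by `t`. -/
def phi (t : F) : Λ →ₗ[F] Λ := (ExteriorAlgebra.map (t • (LinearMap.id : V →ₗ[F] V))).toLinearMap

/-- The set-theoretic basis: `f_E` is the product of the elements of `E` in increasing order. -/
def f (b : Module.Basis ι F V) (E : Finset ι) : Λ :=
  ((E.sort (· ≤ ·)).map fun i => ExteriorAlgebra.ι F (b i)).prod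

/-- Apply a map `D`, written `y ↦ y₁ ⊗ y₂`, on the second strand and reassociate:
`x ⊗ y ↦ (x ⊗ y₁) ⊗ y₂`. -/
def splitRight (D : Λ →ₗ[F] Λ ⊗[F] Λ) : Λ ⊗[F] Λ →ₗ[F] (Λ ⊗[F] Λ) ⊗[F] Λ :=
  (TensorProduct.assoc F Λ Λ Λ).symm.toLinearMap ∘ₗ LinearMap.lTensor Λ D

/-- Apply a map `D`, written `x ↦ x₁ ⊗ x₂`, on the first strand and reassociate:
`x ⊗ y ↦ x₁ ⊗ (x₂ ⊗ y)`. -/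
def splitLeft (D : Λ →ₗ[F] Λ ⊗[F] Λ) : Λ ⊗[F] Λ →ₗ[F] Λ ⊗[F] (Λ ⊗[F] Λ) :=
  (TensorProduct.assoc F Λ Λ Λ).toLinearMap ∘ₗ LinearMap.rTensor Λ D

/-- `Δ_{k)} = (π_k ⊗ id) Δ`. -/
def comulL (b : Module.Basis ι F V) (p : F) (k : ℕ) : Λ →ₗ[F] Λ ⊗[F] Λ :=
  LinearMap.rTensor Λ (proj k) ∘ₗ comul b p

/-- `Δ_{(k} = (id ⊗ π_k) Δ`. -/
def comulR (b : Module.Basis ι F V) (p : F) (k : ℕ) : Λ →ₗ[F] Λ ⊗[F] Λ :=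
  LinearMap.lTensor Λ (proj k) ∘ₗ comul b p

/-- The diagram in which a strand labelled `k` goes from the right line to the left line:
`(∇ ⊗ id)(id ⊗ Δ_{k)})`. -/
def rungL (b : Module.Basis ι F V) (p : F) (k : ℕ) : Module.End F (Λ ⊗[F] Λ) :=
  LinearMap.rTensor Λ nabla ∘ₗ splitRight (comulL b p k)

/-- The diagram in which a strand labelled `k` goes from the left line to the right line:
`(id ⊗ ∇)(Δ_{(k} ⊗ id)`. -/
def rungR (b : Module.Basis ι F V) (p : F) (k : ℕ) : Module.End F (Λ ⊗[F] Λ) :=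
  LinearMap.lTensor Λ nabla ∘ₗ splitLeft (comulR b p k)

/-- The operator `L = (∇ ⊗ id)(id ⊗ Δ_{1)})`. -/
def opL (b : Module.Basis ι F V) (p : F) : Module.End F (Λ ⊗[F] Λ) := rungL b p 1

/-- The operator `R = (id ⊗ ∇)(Δ_{(1} ⊗ id)`. -/
def opR (b : Module.Basis ι F V) (p : F) : Module.End F (Λ ⊗[F] Λ) := rungR b p 1

/-- The right action of the generalised Yetter–Drinfel'd structure,
`λ_R = ∇⁽²⁾ ((S φ_t) ⊗ id ⊗ id)(τ̂ ⊗ id)(id ⊗ Δ)`. -/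
def lambdaR (b : Module.Basis ι F V) (p t : F) : Λ ⊗[F] Λ →ₗ[F] Λ :=
  nabla ∘ₗ LinearMap.rTensor Λ nabla ∘ₗ
    LinearMap.rTensor Λ (LinearMap.rTensor Λ (antipode b p ∘ₗ phi t)) ∘ₗ
      LinearMap.rTensor Λ (tauHat b p) ∘ₗ splitRight (comul b p)

/-- The `R`-matrix `ρ = (φ_t ⊗ λ_R)(τ̂ ⊗ id)(id ⊗ Δ)`. -/
def rho (b : Module.Basis ι F V) (p t : F) : Module.End F (Λ ⊗[F] Λ) :=
  TensorProduct.map (phi t) (lambdaR b p t) ∘ₗ (TensorProduct.assoc F Λ Λ Λ).toLinearMap ∘ₗ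
    LinearMap.rTensor Λ (tauHat b p) ∘ₗ splitRight (comul b p)

end LambdaP
end

noncomputable section

namespace LambdaP

variable {F V ι : Type*} [Field F] [AddCommGroup V] [Module F V] [LinearOrder ι]

local notation "Λ" => ExteriorAlgebra F V

/-! The computation takes place in the braided tensor product algebra `ΛV ⊗ ΛV`, where `Δ` is
multiplicative and `1 ⊗ x` acts by the operator `rightOp x`, so that `τ̂(x ⊗ y) = (1 ⊗ x)(y ⊗ 1)`.
Everything rests on `∇ τ = p ∇` on `V ⊗ V`. Extended to words it reads `∇ τ̂(v ⊗ y) = v φ_p(y)`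
(`mulR_crossAux`), so the antipode acts on degree `k` by the scalar `(-1)^k p^(k(k-1)/2)`
(`antipode_eq_deg`).

Consequently `λ_R` is a multiple of the product: for `x`, `y` of degrees `m`, `n` it gives `(t p^m;
p)_n x y` (`lambdaR_of_mem`). In `ρ(x ⊗ y)` the part of `Δ y` of degree `i` on the left then
contributes `t^i` from `φ_t` and `(t p^m; p)_{n-i}` from `λ_R`, and what remains is the component of
left degree `i` of `(1 ⊗ x) Δ y` (`rho_of_mem`).

To evaluate that component, the antipode is used to write `1 ⊗ x = ∑ (S x₁ ⊗ 1) Δ x₂`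
(`rightOp_eq_unwind`), so `(1 ⊗ x) Δ y = ∑ (S x₁ ⊗ 1) Δ(x₂ y)`. If `x₁` has degree `k`, then `S` is
the scalar `(-1)^k p^(k(k-1)/2)`, passing to `x₁ ⊗ x₂ y` is `R_{m-k}`, and taking left degree `i` is
`L_{i-k}` (`rTensor_proj_rightOp_comul`). This is the MOY form, obtained without any division.

For the divided power form, `L L_j = [j+1]_p L_{j+1}` and `R R_j = [j+1]_p R_{j+1}`, both from the
commutation of `L` and `R` with multiplication by a vector. Reindexing by `i = k + j` collects the
terms in `L` into `W`. -/

/-- Two families of linear maps on the exterior algebra coincide as soon as they coincide at `1`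
and their coincidence is preserved by left multiplication by vectors. -/
theorem ext_left {κ M : Type*} [AddCommGroup M] [Module F M] {f g : κ → Λ →ₗ[F] M}
    (h1 : ∀ k, f k 1 = g k 1)
    (hι : ∀ y, (∀ k, f k y = g k y) → ∀ k v,
      f k (ExteriorAlgebra.ι F v * y) = g k (ExteriorAlgebra.ι F v * y)) (k : κ) (y : Λ) :
    f k y = g k y := by
  induction y using CliffordAlgebra.left_induction generalizing k with
  | algebraMap r => rw [Algebra.algebraMap_eq_smul_one, map_smul, map_smul, h1]
  | add x y hx hy => rw [map_add, map_add, hx, hy]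
  | ι_mul y v hy => exact hι y hy k v

/-! Operators that act by a scalar on each degree. -/

/-- The operator that multiplies the elements of degree `k` by `c k`. -/
def deg (c : ℕ → F) : Λ →ₗ[F] Λ :=
  DirectSum.toModule F ℕ Λ (fun i => c i • (⋀[F]^i V).subtype) ∘ₗ
    (DirectSum.decomposeLinearEquiv fun i : ℕ => ⋀[F]^i V).toLinearMap

theorem deg_of_mem (c : ℕ → F) {n : ℕ} {y : Λ} (hy : y ∈ ⋀[F]^n V) : deg c y = c n • y := by
  lift y to ⋀[F]^n V using hy
  have h : DirectSum.decomposeLinearEquiv (fun i : ℕ => ⋀[F]^i V) (y : Λ) =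
      DirectSum.lof F ℕ (fun i : ℕ => ⋀[F]^i V) n y := DirectSum.decompose_coe (fun i : ℕ => ⋀[F]^i V) y
  rw [deg, LinearMap.comp_apply, LinearEquiv.coe_coe, h, DirectSum.toModule_lof]
  rfl

theorem ι_mul_mem {n : ℕ} {y : Λ} (hy : y ∈ ⋀[F]^n V) (v : V) :
    ExteriorAlgebra.ι F v * y ∈ ⋀[F]^(n + 1) V := by
  rw [ExteriorAlgebra.exteriorPower, pow_succ']
  exact Submodule.mul_mem_mul (LinearMap.mem_range_self _ v) hy

theorem one_mem_zero : (1 : Λ) ∈ ⋀[F]^0 V :=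
  SetLike.GradedOne.one_mem (A := fun i : ℕ => ⋀[F]^i V)

/-- Linear maps on the exterior algebra coincide if they coincide on homogeneous elements. -/
theorem ext_homogeneous {M : Type*} [AddCommGroup M] [Module F M] {f g : Λ →ₗ[F] M}
    (h : ∀ n, ∀ y ∈ ⋀[F]^n V, f y = g y) : f = g := by
  refine LinearMap.ext fun y => ?_
  induction y using DirectSum.Decomposition.inductionOn (fun i : ℕ => ⋀[F]^i V) with
  | zero => simp
  | homogeneous m => exact h _ _ m.2
  | add x y hx hy => rw [map_add, map_add, hx, hy]

theorem deg_one (c : ℕ → F) : deg c (1 : Λ) = c 0 • 1 := deg_of_mem c one_mem_zero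

/-- A vector raises degrees by one, so the weights shift. Identities between degree operators
thereby become recurrences for their weights. -/
theorem deg_ι_mul (c : ℕ → F) (v : V) (y : Λ) :
    deg c (ExteriorAlgebra.ι F v * y) =
      ExteriorAlgebra.ι F v * deg (fun k => c (k + 1)) y := by
  have : deg c ∘ₗ LinearMap.mulLeft F (ExteriorAlgebra.ι F v) =
      LinearMap.mulLeft F (ExteriorAlgebra.ι F v) ∘ₗ deg (fun k => c (k + 1)) :=
    ext_homogeneous fun n y hy => by simp [deg_of_mem _ hy, deg_of_mem _ (ι_mul_mem hy v)]
  exact LinearMap.congr_fun this y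

theorem deg_deg (c d : ℕ → F) (y : Λ) : deg c (deg d y) = deg (fun k => c k * d k) y := by
  have : (deg c : Λ →ₗ[F] Λ) ∘ₗ deg d = deg (fun k => c k * d k) :=
    ext_homogeneous fun n y hy => by simp [deg_of_mem _ hy, smul_smul, mul_comm]
  exact LinearMap.congr_fun this y

theorem smul_deg (a : F) (c : ℕ → F) (y : Λ) : deg (fun k => a * c k) y = a • deg c y := by
  have : (deg (fun k => a * c k) : Λ →ₗ[F] Λ) = a • deg c :=
    ext_homogeneous fun n y hy => by simp [deg_of_mem _ hy, smul_smul]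
  exact LinearMap.congr_fun this y

theorem proj_of_mem {n : ℕ} {y : Λ} (hy : y ∈ ⋀[F]^n V) (k : ℕ) :
    proj k y = if n = k then y else 0 := by
  rw [proj, GradedAlgebra.proj_apply]
  split_ifs with h
  · subst h
    exact DirectSum.decompose_of_mem_same _ hy
  · exact DirectSum.decompose_of_mem_ne _ hy h

theorem proj_mem (k : ℕ) (y : Λ) : proj k y ∈ ⋀[F]^k V := by
  rw [proj, GradedAlgebra.proj_apply]
  exact SetLike.coe_mem _

theorem proj_eq_deg (k : ℕ) : (proj k : Λ →ₗ[F] Λ) = deg fun n => if n = k then 1 else 0 :=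
  ext_homogeneous fun n y hy => by
    rw [proj_of_mem hy, deg_of_mem _ hy]
    split_ifs <;> simp

theorem proj_proj (j k : ℕ) (y : Λ) : proj j (proj k y) = if k = j then proj k y else 0 :=
  proj_of_mem (proj_mem k y) j

theorem phi_ι_mul (t : F) (v : V) (y : Λ) :
    phi t (ExteriorAlgebra.ι F v * y) = t • (ExteriorAlgebra.ι F v * phi t y) := by
  simp [phi]

theorem phi_eq_deg (t : F) : (phi t : Λ →ₗ[F] Λ) = deg fun k => t ^ k := by
  refine LinearMap.ext fun y => ?_
  refine ext_left (κ := Unit) (f := fun _ => phi t) (g := fun _ => deg fun k => t ^ k) ?_ ?_ () y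
  · intro _
    rw [deg_one]
    simp [phi]
  · intro y hy _ v
    simp only [phi_ι_mul, deg_ι_mul, hy (), pow_succ', smul_deg, mul_smul_comm]

/-! Moving a vector through the exterior algebra. -/

theorem mulR_push (c : V) (X : Λ ⊗[F] V) :
    mulR (push V (c ⊗ₜ X)) = ExteriorAlgebra.ι F c * mulR X := by
  induction X with
  | zero => simp
  | add x y hx hy => simp only [TensorProduct.tmul_add, map_add, hx, hy, mul_add]
  | tmul x m => simp [push_tmul, mulR_tmul, mul_assoc]

theorem rTensor_deg_push {M : Type*} [AddCommGroup M] [Module F M] (e : ℕ → F) (c : V)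
    (X : Λ ⊗[F] M) : LinearMap.rTensor M (deg e) (push M (c ⊗ₜ X)) =
      push M (c ⊗ₜ LinearMap.rTensor M (deg fun k => e (k + 1)) X) := by
  induction X with
  | zero => simp
  | add x y hx hy => simp only [TensorProduct.tmul_add, map_add, hx, hy]
  | tmul x m => simp [push_tmul, deg_ι_mul]

/-- The braiding of a vector preserves degrees. -/
theorem crossAux_deg (b : Module.Basis ι F V) (p : F) (c : ℕ → F) (y : Λ) (v : V) :
    crossAux b p (deg c y) v = LinearMap.rTensor V (deg c) (crossAux b p y v) := by
  -- Passing a letter of the word both changes the strand and shifts the weights, so the induction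
  -- must quantify over the two together.
  refine ext_left (κ := (ℕ → F) × V)
    (f := fun k => (crossAux b p).flip k.2 ∘ₗ deg k.1)
    (g := fun k => LinearMap.rTensor V (deg k.1) ∘ₗ (crossAux b p).flip k.2) ?_ ?_ (c, v) y
  · intro k
    simp [deg_one, crossAux_one, TensorProduct.smul_tmul']
  · rintro y hy ⟨c, v⟩ w
    simp only [LinearMap.comp_apply, LinearMap.flip_apply, deg_ι_mul, crossAux_ι_mul,
      step_apply] at hy ⊢
    generalize tau b p (v ⊗ₜ w) = Y
    induction Y with
    | zero => simp
    | add x y hx hy => simp only [map_add, hx, hy]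
    | tmul a d =>
      have := hy (fun k => c (k + 1), d)
      simp only [] at this
      simp only [LinearMap.lTensor_tmul, rTensor_deg_push, this]

/-- The braiding followed by the product, on a vector and an element of the algebra. -/
theorem mulR_crossAux (b : Module.Basis ι F V) (p : F) (y : Λ) (v : V) :
    mulR (crossAux b p y v) = ExteriorAlgebra.ι F v * phi p y := by
  refine ext_left (κ := V) (f := fun v => mulR ∘ₗ (crossAux b p).flip v)
    (g := fun v => LinearMap.mulLeft F (ExteriorAlgebra.ι F v) ∘ₗ phi p) ?_ ?_ v y
  · intro v
    simp [crossAux_one, mulR_tmul, phi]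
  · intro y hy v w
    simp only [LinearMap.comp_apply, LinearMap.flip_apply, LinearMap.mulLeft_apply] at hy ⊢
    rw [crossAux_ι_mul, step_apply, phi_ι_mul]
    -- Once the strand has crossed `w`, the induction hypothesis absorbs it into `y`. Only the
    -- product of the two vectors in `τ(v ⊗ w)` remains, and there `τ` acts as `p`.
    have h : ∀ Y : V ⊗[F] V, mulR (push V (LinearMap.lTensor V (crossAux b p y) Y)) =
        mulL (LinearMap.lTensor V (ExteriorAlgebra.ι F) Y) * phi p y := by
      intro Y
      induction Y with
      | zero => simp
      | add x y hx hy => simp only [map_add, hx, hy, add_mul]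
      | tmul a d => simp only [LinearMap.lTensor_tmul, mulR_push, hy, mulL_tmul, mul_assoc]
    rw [h, mul_tau]
    simp [mulL_tmul, mul_assoc]

/-! ### The antipode on each degree. -/

theorem gauss_succ (p : F) (k : ℕ) : gauss p (k + 1) = -(p ^ k * gauss p k) := by
  rw [gauss, gauss, Nat.choose_succ_succ', Nat.choose_one_right, pow_add, pow_succ]
  ring

theorem gauss_zero (p : F) : gauss p 0 = 1 := by simp [gauss]

/-- Since `S(v y) = -∇ τ̂(v ⊗ S y) = -v φ_p(S y)`, the weight in degree `k + 1` is `-p^k` times the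
weight in degree `k`, which is the recurrence `gauss_succ`. -/
theorem antipode_eq_deg (b : Module.Basis ι F V) (p : F) : antipode b p = deg (gauss p) := by
  refine LinearMap.ext fun y => ?_
  refine ext_left (κ := Unit) (f := fun _ => antipode b p) (g := fun _ => deg (gauss p)) ?_ ?_ () y
  · intro _
    rw [deg_one]
    simp [antipode, gauss_zero]
  · intro y hy _ v
    have h : antipode b p (ExteriorAlgebra.ι F v * y) = antiStep b p v (antipode b p y) := by
      simp [antipode]
    have h' : (fun k => gauss p (k + 1)) = fun k => (-1) * (p ^ k * gauss p k) := by
      funext k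
      rw [gauss_succ]
      ring
    rw [h, antiStep_apply, mulR_crossAux, hy (), phi_eq_deg, deg_deg, deg_ι_mul, h', smul_deg]
    simp

/-! Operators on `ΛV ⊗ ΛV`. -/

/-- Left multiplication by `a ⊗ 1` on `ΛV ⊗ ΛV`. -/
def leftMul : Λ →ₗ[F] Module.End F (Λ ⊗[F] Λ) := LinearMap.rTensorHom Λ ∘ₗ LinearMap.mul F Λ

theorem leftMul_tmul (a x y : Λ) : leftMul a (x ⊗ₜ[F] y) = (a * x) ⊗ₜ y := by simp [leftMul]

theorem leftMul_one : leftMul (1 : Λ) = 1 := TensorProduct.ext' fun x y => by simp [leftMul_tmul]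

theorem leftMul_ι_mul (v : V) (a : Λ) :
    leftMul (ExteriorAlgebra.ι F v * a) = mulLeft v * leftMul a :=
  TensorProduct.ext' fun x y => by simp [leftMul_tmul, mulLeft_apply, push_tmul, mul_assoc]

theorem leftMul_mul_ι (v : V) (a : Λ) :
    leftMul (a * ExteriorAlgebra.ι F v) = leftMul a * mulLeft v :=
  TensorProduct.ext' fun x y => by simp [leftMul_tmul, mulLeft_apply, push_tmul, mul_assoc]

theorem mulLeft_tmul (v : V) (x y : Λ) :
    mulLeft v (x ⊗ₜ[F] y) = (ExteriorAlgebra.ι F v * x) ⊗ₜ y := by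
  rw [mulLeft_apply, push_tmul]

/-- Left multiplication by `1 ⊗ x` in the braided tensor product algebra `ΛV ⊗ ΛV`. -/
def rightOp (b : Module.Basis ι F V) (p : F) : Λ →ₐ[F] Module.End F (Λ ⊗[F] Λ) :=
  ExteriorAlgebra.lift F ⟨mulRight b p, mulRight_sq b p⟩

/-- Left multiplication by `Δ x` in the braided tensor product algebra `ΛV ⊗ ΛV`. -/
def comulOp (b : Module.Basis ι F V) (p : F) : Λ →ₐ[F] Module.End F (Λ ⊗[F] Λ) :=
  ExteriorAlgebra.lift F ⟨mulLeft + mulRight b p, coprod_sq b p⟩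

theorem rightOp_ι_mul (b : Module.Basis ι F V) (p : F) (v : V) (x : Λ) :
    rightOp b p (ExteriorAlgebra.ι F v * x) = mulRight b p v * rightOp b p x := by
  simp [rightOp]

theorem comulOp_ι_mul (b : Module.Basis ι F V) (p : F) (v : V) (x : Λ) :
    comulOp b p (ExteriorAlgebra.ι F v * x) =
      mulLeft v * comulOp b p x + mulRight b p v * comulOp b p x := by
  simp [comulOp, add_mul]

theorem comul_eq (b : Module.Basis ι F V) (p : F) (x : Λ) :
    comul b p x = comulOp b p x (1 ⊗ₜ 1) := rfl

theorem comul_one (b : Module.Basis ι F V) (p : F) : comul b p (1 : Λ) = 1 ⊗ₜ 1 := by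
  simp [comul_eq]

theorem comul_mul (b : Module.Basis ι F V) (p : F) (x y : Λ) :
    comul b p (x * y) = comulOp b p x (comul b p y) := by
  simp [comul_eq]

theorem comul_ι_mul (b : Module.Basis ι F V) (p : F) (v : V) (x : Λ) :
    comul b p (ExteriorAlgebra.ι F v * x) =
      mulLeft v (comul b p x) + mulRight b p v (comul b p x) := by
  simp [comul_eq, comulOp_ι_mul]

theorem tauHat_tmul (b : Module.Basis ι F V) (p : F) (x y : Λ) :
    tauHat b p (x ⊗ₜ y) = rightOp b p x (y ⊗ₜ 1) := rfl

theorem mulRight_one_tmul (b : Module.Basis ι F V) (p : F) (v : V) (y : Λ) :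
    mulRight b p v (1 ⊗ₜ y) = 1 ⊗ₜ (ExteriorAlgebra.ι F v * y) := by
  simp [mulRight_tmul, crossAux_one, mulL_tmul]

/-- The operator `leftMul a * mulRight v`, for `a ⊗ v`. -/
def slide (b : Module.Basis ι F V) (p : F) : Λ ⊗[F] V →ₗ[F] Module.End F (Λ ⊗[F] Λ) :=
  LinearMap.mul' F _ ∘ₗ TensorProduct.map leftMul (mulRight b p)

theorem slide_tmul (b : Module.Basis ι F V) (p : F) (a : Λ) (v : V) :
    slide b p (a ⊗ₜ v) = leftMul a * mulRight b p v := by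
  simp [slide]

theorem slide_push (b : Module.Basis ι F V) (p : F) (c : V) (X : Λ ⊗[F] V) :
    slide b p (push V (c ⊗ₜ X)) = mulLeft c * slide b p X := by
  induction X with
  | zero => simp
  | add x y hx hy => simp only [TensorProduct.tmul_add, map_add, hx, hy, mul_add]
  | tmul x m => simp [push_tmul, slide_tmul, leftMul_ι_mul, mul_assoc]

/-- The defining relation of the braided tensor product: if `τ(v ⊗ w)` is `∑ c ⊗ d`, then `(1 ⊗ v)(w
⊗ 1) = ∑ (c ⊗ 1)(1 ⊗ d)`. -/
theorem mulRight_mul_mulLeft (b : Module.Basis ι F V) (p : F) (v w : V) :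
    mulRight b p v * mulLeft w =
      (LinearMap.mul' F _ ∘ₗ TensorProduct.map mulLeft (mulRight b p)) (tau b p (v ⊗ₜ w)) := by
  refine TensorProduct.ext' fun z y => ?_
  rw [Module.End.mul_apply, mulLeft_tmul, mulRight_tmul, crossAux_ι_mul, step_apply]
  generalize tau b p (v ⊗ₜ w) = Y
  induction Y with
  | zero => simp
  | add x y hx hy =>
    simp only [map_add, hx, hy, TensorProduct.add_tmul, LinearMap.add_apply]
  | tmul c d =>
    simp only [LinearMap.lTensor_tmul, LinearMap.comp_apply, TensorProduct.map_tmul,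
      LinearMap.mul'_apply, Module.End.mul_apply, mulRight_tmul]
    generalize crossAux b p z d = X
    induction X with
    | zero => simp
    | add x y hx hy =>
      simp only [TensorProduct.tmul_add, TensorProduct.add_tmul, map_add, hx, hy]
    | tmul x m => simp [push_tmul, mulLeft_apply]

/-- Moving a vector past a left multiplication. -/
theorem mulRight_mul_leftMul (b : Module.Basis ι F V) (p : F) (v : V) (a : Λ) :
    mulRight b p v * leftMul a = slide b p (crossAux b p a v) := by
  refine ext_left (κ := V) (f := fun v => LinearMap.mulLeft F (mulRight b p v) ∘ₗ leftMul)
    (g := fun v => slide b p ∘ₗ (crossAux b p).flip v) ?_ ?_ v a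
  · intro v
    simp [crossAux_one, slide_tmul, leftMul_one]
  · intro y hy v w
    simp only [LinearMap.comp_apply, LinearMap.mulLeft_apply, LinearMap.flip_apply] at hy ⊢
    rw [leftMul_ι_mul, ← mul_assoc, mulRight_mul_mulLeft, crossAux_ι_mul, step_apply]
    generalize tau b p (v ⊗ₜ w) = Y
    induction Y with
    | zero => simp
    | add x y hx hy => simp only [map_add, add_mul, hx, hy]
    | tmul c d =>
      simp only [LinearMap.lTensor_tmul, slide_push, LinearMap.comp_apply, TensorProduct.map_tmul,
        LinearMap.mul'_apply, mul_assoc, hy]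

theorem mulRight_leftMul (b : Module.Basis ι F V) (p : F) (v : V) (a : Λ) (X : Λ ⊗[F] Λ) :
    mulRight b p v (leftMul a X) = slide b p (crossAux b p a v) X :=
  LinearMap.congr_fun (mulRight_mul_leftMul b p v a) X

/-- The braided commutation of two vectors on the right strand. -/
theorem mulRight_tau (b : Module.Basis ι F V) (p : F) (X : V ⊗[F] V) :
    (LinearMap.mul' F _ ∘ₗ TensorProduct.map (mulRight b p) (mulRight b p)) (tau b p X) =
      p • (LinearMap.mul' F _ ∘ₗ TensorProduct.map (mulRight b p) (mulRight b p)) X := by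
  -- As `rightOp` is an algebra map, the composite factors through the product `V ⊗ V → ΛV`, on
  -- which `τ` acts as `p`.
  have h : LinearMap.mul' F _ ∘ₗ TensorProduct.map (mulRight b p) (mulRight b p) =
      (rightOp b p).toLinearMap ∘ₗ mulL ∘ₗ LinearMap.lTensor V (ExteriorAlgebra.ι F) :=
    TensorProduct.ext' fun v w => by simp [rightOp, mulL_tmul]
  rw [h]
  simp only [LinearMap.comp_apply, mul_tau, map_smul]

/-! Degrees. -/

theorem mulRight_rTensor_deg (b : Module.Basis ι F V) (p : F) (v : V) (c : ℕ → F)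
    (X : Λ ⊗[F] Λ) : mulRight b p v (LinearMap.rTensor Λ (deg c) X) =
      LinearMap.rTensor Λ (deg c) (mulRight b p v X) := by
  induction X with
  | zero => simp
  | add x y hx hy => simp only [map_add, hx, hy]
  | tmul z y =>
    rw [LinearMap.rTensor_tmul, mulRight_tmul, mulRight_tmul, crossAux_deg]
    generalize crossAux b p z v = X
    induction X with
    | zero => simp
    | add x y hx hy => simp only [TensorProduct.add_tmul, map_add, hx, hy]
    | tmul x m => simp

theorem lTensor_deg_mulRight (b : Module.Basis ι F V) (p : F) (v : V) (c : ℕ → F)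
    (X : Λ ⊗[F] Λ) : LinearMap.lTensor Λ (deg c) (mulRight b p v X) =
      mulRight b p v (LinearMap.lTensor Λ (deg fun k => c (k + 1)) X) := by
  induction X with
  | zero => simp
  | add x y hx hy => simp only [map_add, hx, hy]
  | tmul z y =>
    rw [LinearMap.lTensor_tmul, mulRight_tmul, mulRight_tmul]
    generalize crossAux b p z v = X
    induction X with
    | zero => simp
    | add x y hx hy => simp only [TensorProduct.add_tmul, map_add, hx, hy]
    | tmul x m => simp [mulL_tmul, deg_ι_mul]

theorem rTensor_deg_mulLeft (v : V) (c : ℕ → F) (X : Λ ⊗[F] Λ) :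
    LinearMap.rTensor Λ (deg c) (mulLeft v X) =
      mulLeft v (LinearMap.rTensor Λ (deg fun k => c (k + 1)) X) :=
  rTensor_deg_push c v X

theorem lTensor_mulLeft (f : Λ →ₗ[F] Λ) (v : V) (X : Λ ⊗[F] Λ) :
    LinearMap.lTensor Λ f (mulLeft v X) = mulLeft v (LinearMap.lTensor Λ f X) := by
  induction X with
  | zero => simp
  | add x y hx hy => simp only [map_add, hx, hy]
  | tmul x y => simp [mulLeft_tmul]

theorem deg_zero : deg (fun _ => 0) = (0 : Λ →ₗ[F] Λ) :=
  ext_homogeneous fun n y hy => by simp [deg_of_mem _ hy]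

theorem rTensor_proj_zero_mulLeft (v : V) (X : Λ ⊗[F] Λ) :
    LinearMap.rTensor Λ (proj 0) (mulLeft v X) = 0 := by
  rw [proj_eq_deg, rTensor_deg_mulLeft]
  simp [deg_zero]

theorem rTensor_proj_succ_mulLeft (k : ℕ) (v : V) (X : Λ ⊗[F] Λ) :
    LinearMap.rTensor Λ (proj (k + 1)) (mulLeft v X) =
      mulLeft v (LinearMap.rTensor Λ (proj k) X) := by
  rw [proj_eq_deg, rTensor_deg_mulLeft, proj_eq_deg]
  simp

theorem rTensor_proj_mulRight (b : Module.Basis ι F V) (p : F) (k : ℕ) (v : V) (X : Λ ⊗[F] Λ) :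
    LinearMap.rTensor Λ (proj k) (mulRight b p v X) =
      mulRight b p v (LinearMap.rTensor Λ (proj k) X) := by
  rw [proj_eq_deg, mulRight_rTensor_deg]

theorem lTensor_proj_zero_mulRight (b : Module.Basis ι F V) (p : F) (v : V) (X : Λ ⊗[F] Λ) :
    LinearMap.lTensor Λ (proj 0) (mulRight b p v X) = 0 := by
  rw [proj_eq_deg, lTensor_deg_mulRight]
  simp [deg_zero]

theorem lTensor_proj_succ_mulRight (b : Module.Basis ι F V) (p : F) (k : ℕ) (v : V)
    (X : Λ ⊗[F] Λ) : LinearMap.lTensor Λ (proj (k + 1)) (mulRight b p v X) =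
      mulRight b p v (LinearMap.lTensor Λ (proj k) X) := by
  rw [proj_eq_deg, lTensor_deg_mulRight, proj_eq_deg]
  simp

/-- One of the two counit laws: in left degree zero only the summand `1 ⊗ v` of each `Δ v` survives.
-/
theorem rTensor_proj_zero_comul (b : Module.Basis ι F V) (p : F) (y : Λ) :
    LinearMap.rTensor Λ (proj 0) (comul b p y) = 1 ⊗ₜ y := by
  refine ext_left (κ := Unit) (f := fun _ => LinearMap.rTensor Λ (proj 0) ∘ₗ comul b p)
    (g := fun _ => TensorProduct.mk F Λ Λ 1) ?_ ?_ () y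
  · intro _
    simp [comul_one, proj_of_mem one_mem_zero]
  · intro y hy _ v
    have := hy ()
    simp only [LinearMap.comp_apply, TensorProduct.mk_apply] at this ⊢
    rw [comul_ι_mul, map_add, rTensor_proj_zero_mulLeft, rTensor_proj_mulRight, this, zero_add,
      mulRight_one_tmul]

theorem lTensor_proj_zero_comul (b : Module.Basis ι F V) (p : F) (x : Λ) :
    LinearMap.lTensor Λ (proj 0) (comul b p x) = x ⊗ₜ 1 := by
  refine ext_left (κ := Unit) (f := fun _ => LinearMap.lTensor Λ (proj 0) ∘ₗ comul b p)
    (g := fun _ => (TensorProduct.mk F Λ Λ).flip 1) ?_ ?_ () x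
  · intro _
    simp [comul_one, proj_of_mem one_mem_zero]
  · intro y hy _ v
    have := hy ()
    simp only [LinearMap.comp_apply, TensorProduct.mk_apply, LinearMap.flip_apply] at this ⊢
    rw [comul_ι_mul, map_add, lTensor_proj_zero_mulRight, lTensor_mulLeft, this, add_zero,
      mulLeft_tmul]

/-! ### Total degree in the tensor square. -/

/-- The part of `ΛV ⊗ ΛV` of total degree `n`. -/
def totalDeg (F V : Type*) [Field F] [AddCommGroup V] [Module F V] (n : ℕ) :
    Submodule F (ExteriorAlgebra F V ⊗[F] ExteriorAlgebra F V) :=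
  Submodule.span F {z | ∃ i j, i + j = n ∧ ∃ x ∈ ⋀[F]^i V, ∃ y ∈ ⋀[F]^j V, z = x ⊗ₜ y}

theorem tmul_mem_totalDeg {i j : ℕ} {x y : Λ} (hx : x ∈ ⋀[F]^i V) (hy : y ∈ ⋀[F]^j V) :
    x ⊗ₜ y ∈ totalDeg F V (i + j) :=
  Submodule.subset_span ⟨i, j, rfl, x, hx, y, hy, rfl⟩

theorem totalDeg_induction {n : ℕ} {P : Λ ⊗[F] Λ → Prop} (zero : P 0)
    (add : ∀ X Y, P X → P Y → P (X + Y))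
    (tmul : ∀ i j, i + j = n → ∀ x ∈ ⋀[F]^i V, ∀ y ∈ ⋀[F]^j V, P (x ⊗ₜ y))
    {X : Λ ⊗[F] Λ} (hX : X ∈ totalDeg F V n) : P X := by
  -- `P` is not assumed stable under scalars. Carrying an arbitrary scalar lets it be absorbed into
  -- the left factor of a generator.
  suffices h : ∀ c : F, P (c • X) by simpa using h 1
  induction hX using Submodule.span_induction with
  | mem X h =>
    intro c
    obtain ⟨i, j, hij, x, hx, y, hy, rfl⟩ := h
    rw [TensorProduct.smul_tmul']
    exact tmul i j hij _ (Submodule.smul_mem _ c hx) y hy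
  | zero => intro c; rwa [smul_zero]
  | add X Y _ _ hX hY => intro c; rw [smul_add]; exact add _ _ (hX c) (hY c)
  | smul d X _ hX => intro c; rw [smul_smul]; exact hX _

theorem mulLeft_mem_totalDeg {n : ℕ} {X : Λ ⊗[F] Λ} (hX : X ∈ totalDeg F V n) (v : V) :
    mulLeft v X ∈ totalDeg F V (n + 1) := by
  refine totalDeg_induction (P := fun X => mulLeft v X ∈ totalDeg F V (n + 1)) (by simp)
    (fun X Y hX hY => by rw [map_add]; exact add_mem hX hY) ?_ hX
  rintro i j rfl x hx y hy
  rw [mulLeft_tmul, add_right_comm]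
  exact tmul_mem_totalDeg (ι_mul_mem hx v) hy

theorem mulRight_mem_totalDeg (b : Module.Basis ι F V) (p : F) {n : ℕ} {X : Λ ⊗[F] Λ}
    (hX : X ∈ totalDeg F V n) (v : V) : mulRight b p v X ∈ totalDeg F V (n + 1) := by
  refine totalDeg_induction (P := fun X => mulRight b p v X ∈ totalDeg F V (n + 1)) (by simp)
    (fun X Y hX hY => by rw [map_add]; exact add_mem hX hY) ?_ hX
  rintro i j rfl x hx y hy
  -- Inserting the projection records that the crossed strand still has degree `i`, a fact that
  -- would be lost when the braided tensor is generalised.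
  have h : crossAux b p x v = LinearMap.rTensor V (proj i) (crossAux b p x v) := by
    rw [proj_eq_deg, ← crossAux_deg, deg_of_mem _ hx]
    simp
  rw [mulRight_tmul, h]
  generalize crossAux b p x v = Y
  induction Y with
  | zero => simp
  | add Y Z hY hZ => simp only [map_add, TensorProduct.add_tmul]; exact add_mem hY hZ
  | tmul a c =>
    simp only [LinearMap.rTensor_tmul, TensorProduct.assoc_tmul, LinearMap.lTensor_tmul, mulL_tmul]
    rw [add_assoc]
    exact tmul_mem_totalDeg (proj_mem i a) (ι_mul_mem hy c)

/-- Homogeneous elements are sums of products of vectors. -/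
theorem homogeneous_induction {P : ℕ → Λ → Prop} (one : P 0 1)
    (smul : ∀ n (c : F) x, P n x → P n (c • x))
    (add : ∀ n x y, P n x → P n y → P n (x + y))
    (ι_mul : ∀ n v x, x ∈ ⋀[F]^n V → P n x → P (n + 1) (ExteriorAlgebra.ι F v * x))
    {n : ℕ} {x : Λ} (hx : x ∈ ⋀[F]^n V) : P n x := by
  refine Submodule.pow_induction_on_left' (LinearMap.range (ExteriorAlgebra.ι F : V →ₗ[F] Λ))
    (C := fun n x _ => P n x) (fun r => ?_) (fun x y i _ _ ihx ihy => add i x y ihx ihy) ?_ hx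
  · have := smul 0 r 1 one
    rwa [← Algebra.algebraMap_eq_smul_one] at this
  · rintro m ⟨v, rfl⟩ i x hx ih
    exact ι_mul i v x hx ih

theorem comul_mem_totalDeg (b : Module.Basis ι F V) (p : F) {n : ℕ} {x : Λ}
    (hx : x ∈ ⋀[F]^n V) : comul b p x ∈ totalDeg F V n := by
  refine homogeneous_induction (P := fun n x => comul b p x ∈ totalDeg F V n) ?_ ?_ ?_ ?_ hx
  · rw [comul_one]
    exact tmul_mem_totalDeg (i := 0) (j := 0) one_mem_zero one_mem_zero
  · intro n c x hx
    rw [map_smul]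
    exact Submodule.smul_mem _ c hx
  · intro n x y hx hy
    rw [map_add]
    exact add_mem hx hy
  · intro n v x _ hx
    rw [comul_ι_mul]
    exact add_mem (mulLeft_mem_totalDeg hx v) (mulRight_mem_totalDeg b p hx v)

theorem rightOp_mem_totalDeg (b : Module.Basis ι F V) (p : F) {m n : ℕ} {x : Λ}
    (hx : x ∈ ⋀[F]^m V) {X : Λ ⊗[F] Λ} (hX : X ∈ totalDeg F V n) :
    rightOp b p x X ∈ totalDeg F V (m + n) := by
  refine homogeneous_induction (P := fun m x => rightOp b p x X ∈ totalDeg F V (m + n))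
    ?_ ?_ ?_ ?_ hx
  · simpa using hX
  · intro n c x hx
    rw [map_smul]
    exact Submodule.smul_mem _ c hx
  · intro n x y hx hy
    rw [map_add]
    exact add_mem hx hy
  · intro k v x _ hx
    rw [rightOp_ι_mul, add_right_comm]
    exact mulRight_mem_totalDeg b p hx v

/-- An element of total degree `n` whose first degree is `i` has second degree `n - i`. -/
theorem rTensor_proj_of_totalDeg {n : ℕ} {X : Λ ⊗[F] Λ} (hX : X ∈ totalDeg F V n) {i : ℕ}
    (hi : i ≤ n) : LinearMap.rTensor Λ (proj i) X = TensorProduct.map (proj i) (proj (n - i)) X := by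
  refine totalDeg_induction (P := fun X => LinearMap.rTensor Λ (proj i) X =
    TensorProduct.map (proj i) (proj (n - i)) X) (by simp)
    (fun X Y hX hY => by rw [map_add, map_add, hX, hY]) ?_ hX
  rintro k j rfl x hx y hy
  rw [LinearMap.rTensor_tmul, TensorProduct.map_tmul, proj_of_mem hx, proj_of_mem hy]
  by_cases h : k = i
  · subst h
    simp
  · simp [h]

/-! The right action. -/

/-- The first factor is split off because removing a vector from a word replaces `t` by `t p`. -/
theorem qPoch_succ (x q : F) (n : ℕ) : qPoch x q (n + 1) = (1 - x) * qPoch (x * q) q n := by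
  rw [qPoch, qPoch, Finset.prod_range_succ', mul_comm, pow_zero, mul_one]
  congr 1
  exact Finset.prod_congr rfl fun i _ => by rw [pow_succ', mul_assoc]

/-- `1 ⊗ v` reaches the second factor from the left only. Hence `rightOp x` is determined by its
values on `y ⊗ 1`, that is, by `τ̂`. -/
theorem mulRight_lTensor_mulRight (b : Module.Basis ι F V) (p : F) (v : V) (y : Λ)
    (X : Λ ⊗[F] Λ) : mulRight b p v (LinearMap.lTensor Λ (LinearMap.mulRight F y) X) =
      LinearMap.lTensor Λ (LinearMap.mulRight F y) (mulRight b p v X) := by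
  induction X with
  | zero => simp
  | add x y hx hy => simp only [map_add, hx, hy]
  | tmul z w =>
    rw [LinearMap.lTensor_tmul, mulRight_tmul, mulRight_tmul]
    generalize crossAux b p z v = X
    induction X with
    | zero => simp
    | add x y hx hy => simp only [TensorProduct.add_tmul, map_add, hx, hy]
    | tmul x m => simp [mulL_tmul, mul_assoc]

theorem rightOp_lTensor_mulRight (b : Module.Basis ι F V) (p : F) (x y : Λ) (X : Λ ⊗[F] Λ) :
    rightOp b p x (LinearMap.lTensor Λ (LinearMap.mulRight F y) X) =
      LinearMap.lTensor Λ (LinearMap.mulRight F y) (rightOp b p x X) := by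
  refine ext_left (κ := Unit) (f := fun _ => LinearMap.applyₗ
      (LinearMap.lTensor Λ (LinearMap.mulRight F y) X) ∘ₗ (rightOp b p).toLinearMap)
    (g := fun _ => LinearMap.lTensor Λ (LinearMap.mulRight F y) ∘ₗ
      LinearMap.applyₗ X ∘ₗ (rightOp b p).toLinearMap) ?_ ?_ () x
  · intro _
    simp
  · intro x hx _ v
    have := hx ()
    simp only [LinearMap.comp_apply, LinearMap.applyₗ_apply_apply, AlgHom.toLinearMap_apply]
      at this ⊢
    rw [rightOp_ι_mul, Module.End.mul_apply, Module.End.mul_apply, this, mulRight_lTensor_mulRight]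

theorem rightOp_tmul (b : Module.Basis ι F V) (p : F) (x y z : Λ) :
    rightOp b p x (y ⊗ₜ z) =
      LinearMap.lTensor Λ (LinearMap.mulRight F z) (rightOp b p x (y ⊗ₜ 1)) := by
  rw [← rightOp_lTensor_mulRight]
  simp

theorem rTensor_proj_rightOp (b : Module.Basis ι F V) (p : F) (k : ℕ) (x : Λ) (X : Λ ⊗[F] Λ) :
    LinearMap.rTensor Λ (proj k) (rightOp b p x X) =
      rightOp b p x (LinearMap.rTensor Λ (proj k) X) := by
  refine ext_left (κ := Unit) (f := fun _ => LinearMap.rTensor Λ (proj k) ∘ₗ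
      LinearMap.applyₗ X ∘ₗ (rightOp b p).toLinearMap)
    (g := fun _ => LinearMap.applyₗ (LinearMap.rTensor Λ (proj k) X) ∘ₗ
      (rightOp b p).toLinearMap) ?_ ?_ () x
  · intro _
    simp
  · intro x hx _ v
    have := hx ()
    simp only [LinearMap.comp_apply, LinearMap.applyₗ_apply_apply, AlgHom.toLinearMap_apply]
      at this ⊢
    rw [rightOp_ι_mul, Module.End.mul_apply, Module.End.mul_apply, rTensor_proj_mulRight, this]

/-! ### The scalar by which the right action multiplies the product. -/

/-- The map `∇ (S φ_t ⊗ id)`. -/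
def antiMul (p t : F) : Λ ⊗[F] Λ →ₗ[F] Λ :=
  nabla ∘ₗ LinearMap.rTensor Λ (deg fun k => gauss p k * t ^ k)

theorem antiMul_tmul (p t : F) (x y : Λ) :
    antiMul p t (x ⊗ₜ y) = deg (fun k => gauss p k * t ^ k) x * y := by
  simp [antiMul, nabla]

/-- Multiplying `τ̂(x ⊗ y₁)` on the right by `1 ⊗ y₂` gives `(1 ⊗ x) Δ y`. Associativity of `∇` then
regroups the triple product. -/
theorem lambdaR_tmul (b : Module.Basis ι F V) (p t : F) (x y : Λ) :
    lambdaR b p t (x ⊗ₜ y) = antiMul p t (rightOp b p x (comul b p y)) := by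
  have hS : antipode b p ∘ₗ phi t = deg fun k => gauss p k * t ^ k := by
    rw [antipode_eq_deg, phi_eq_deg]
    exact LinearMap.ext fun y => deg_deg _ _ y
  rw [lambdaR, hS]
  simp only [splitRight, LinearMap.comp_apply, LinearMap.lTensor_tmul]
  generalize comul b p y = Y
  induction Y with
  | zero => simp
  | add x y hx hy => simp only [TensorProduct.tmul_add, map_add, hx, hy]
  | tmul y z =>
    simp only [LinearEquiv.coe_coe, TensorProduct.assoc_symm_tmul, LinearMap.rTensor_tmul,
      tauHat_tmul, rightOp_tmul b p x y z]
    generalize rightOp b p x (y ⊗ₜ 1) = Z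
    induction Z with
    | zero => simp
    | add x y hx hy => simp only [TensorProduct.add_tmul, map_add, hx, hy]
    | tmul c d => simp [antiMul_tmul, nabla, mul_assoc]

/-- The weights of `S φ_t` in degrees `k + 1` and `k` have ratio `-t p^k`. The `p^k` is absorbed by
changing `t` to `t p`. -/
theorem antiMul_mulLeft (p t : F) (v : V) (X : Λ ⊗[F] Λ) :
    antiMul p t (mulLeft v X) = -t • (ExteriorAlgebra.ι F v * antiMul p (t * p) X) := by
  induction X with
  | zero => simp
  | add x y hx hy => simp only [map_add, hx, hy, mul_add, smul_add]
  | tmul x y =>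
    have h : (fun k => gauss p (k + 1) * t ^ (k + 1)) =
        fun k => -t * (gauss p k * (t * p) ^ k) := by
      funext k
      rw [gauss_succ, mul_pow]
      ring
    rw [mulLeft_tmul, antiMul_tmul, antiMul_tmul, deg_ι_mul, h, smul_deg]
    simp [mul_assoc]

/-- `S φ_t` preserves degree, so it commutes with the braiding. Then `∇ τ̂(v ⊗ z) = v φ_p(z)` brings
`v` to the front at the price of changing `t` to `t p`. -/
theorem antiMul_mulRight (b : Module.Basis ι F V) (p t : F) (v : V) (X : Λ ⊗[F] Λ) :
    antiMul p t (mulRight b p v X) = ExteriorAlgebra.ι F v * antiMul p (t * p) X := by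
  induction X with
  | zero => simp
  | add x y hx hy => simp only [map_add, hx, hy, mul_add]
  | tmul x y =>
    have h : ∀ X : Λ ⊗[F] V, antiMul p t (LinearMap.lTensor Λ mulL
        (TensorProduct.assoc F Λ V Λ (X ⊗ₜ y))) =
        mulR (LinearMap.rTensor V (deg fun k => gauss p k * t ^ k) X) * y := by
      intro X
      induction X with
      | zero => simp
      | add x y hx hy => simp only [TensorProduct.add_tmul, map_add, hx, hy, add_mul]
      | tmul a c => simp [antiMul_tmul, mulL_tmul, mulR_tmul, mul_assoc]
    have h' : (fun k => p ^ k * (gauss p k * t ^ k)) = fun k => gauss p k * (t * p) ^ k := by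
      funext k
      rw [mul_pow]
      ring
    rw [mulRight_tmul, h, ← crossAux_deg, mulR_crossAux, phi_eq_deg, deg_deg, h', antiMul_tmul,
      mul_assoc]

/-- The summands `v ⊗ 1` and `1 ⊗ v` of `Δ v` contribute `-t` and `1` times the same element, hence
a factor `1 - t`, with `t p` in place of `t` for the rest of the word. The induction therefore runs
over all `t`. -/
theorem antiMul_comul (b : Module.Basis ι F V) (p t : F) {n : ℕ} {y : Λ} (hy : y ∈ ⋀[F]^n V) :
    antiMul p t (comul b p y) = qPoch t p n • y := by
  refine homogeneous_induction (P := fun n y => ∀ t, antiMul p t (comul b p y) = qPoch t p n • y)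
    ?_ ?_ ?_ ?_ hy t
  · intro t
    rw [comul_one, antiMul_tmul, deg_one]
    simp [gauss_zero, qPoch]
  · intro n c x hx t
    rw [map_smul, map_smul, hx, smul_comm]
  · intro n x y hx hy t
    rw [map_add, map_add, hx, hy, smul_add]
  · intro n v x _ hx t
    rw [comul_ι_mul, map_add, antiMul_mulLeft, antiMul_mulRight, hx, qPoch_succ, mul_smul_comm]
    module

theorem antiMul_rightOp (b : Module.Basis ι F V) (p t : F) {m : ℕ} {x : Λ} (hx : x ∈ ⋀[F]^m V)
    (X : Λ ⊗[F] Λ) : antiMul p t (rightOp b p x X) = x * antiMul p (t * p ^ m) X := by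
  refine homogeneous_induction
    (P := fun m x => ∀ t, antiMul p t (rightOp b p x X) = x * antiMul p (t * p ^ m) X)
    ?_ ?_ ?_ ?_ hx t
  · intro t
    simp
  · intro n c x hx t
    rw [map_smul, LinearMap.smul_apply, map_smul, hx, smul_mul_assoc]
  · intro n x y hx hy t
    rw [map_add, LinearMap.add_apply, map_add, hx, hy, add_mul]
  · intro n v x _ hx t
    rw [rightOp_ι_mul, Module.End.mul_apply, antiMul_mulRight, hx, mul_assoc t, ← pow_succ',
      mul_assoc]

/-- The right action `λ_R` is a multiple of the product. -/
theorem lambdaR_of_mem (b : Module.Basis ι F V) (p t : F) {m n : ℕ} {x y : Λ}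
    (hx : x ∈ ⋀[F]^m V) (hy : y ∈ ⋀[F]^n V) :
    lambdaR b p t (x ⊗ₜ y) = qPoch (t * p ^ m) p n • (x * y) := by
  rw [lambdaR_tmul, antiMul_rightOp b p t hx, antiMul_comul b p _ hy, mul_smul_comm]

/-- The `R`-matrix on homogeneous elements. -/
theorem rho_of_mem (b : Module.Basis ι F V) (p t : F) {m n : ℕ} {x y : Λ}
    (hx : x ∈ ⋀[F]^m V) (hy : y ∈ ⋀[F]^n V) :
    rho b p t (x ⊗ₜ y) = ∑ i ∈ Finset.range (n + 1), (t ^ i * qPoch (t * p ^ m) p (n - i)) •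
      LinearMap.rTensor Λ (proj i) (rightOp b p x (comul b p y)) := by
  simp only [rho, splitRight, LinearMap.comp_apply, LinearMap.lTensor_tmul]
  -- Both sides are linear in `Δ y`, so `Δ y` may be replaced by a pure tensor of bidegree `(i, j)`
  -- with `i + j = n`. Only the `i`-th summand on the right then survives.
  refine totalDeg_induction (P := fun Y => TensorProduct.map (phi t) (lambdaR b p t)
    ((TensorProduct.assoc F Λ Λ Λ).toLinearMap (LinearMap.rTensor Λ (tauHat b p)
      ((TensorProduct.assoc F Λ Λ Λ).symm.toLinearMap (x ⊗ₜ Y)))) =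
    ∑ i ∈ Finset.range (n + 1), (t ^ i * qPoch (t * p ^ m) p (n - i)) •
      LinearMap.rTensor Λ (proj i) (rightOp b p x Y)) ?_ ?_ ?_ (comul_mem_totalDeg b p hy)
  · simp
  · intro X Y hX hY
    simp only [TensorProduct.tmul_add, map_add, smul_add, Finset.sum_add_distrib, hX, hY]
  · rintro i j rfl y hy z hz
    rw [Finset.sum_eq_single i]
    · have hZ := rightOp_mem_totalDeg b p hx (tmul_mem_totalDeg hy (one_mem_zero (V := V)))
      -- `τ̂(x ⊗ y)` has bidegree `(i, m)`: this makes `φ_t` act as `t^i` and fixes the parameter `t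
      -- p^m` in `λ_R`.
      have hi : rightOp b p x (y ⊗ₜ 1) =
          TensorProduct.map (proj i) (proj m) (rightOp b p x (y ⊗ₜ 1)) := by
        have h := rTensor_proj_of_totalDeg hZ (i := i) (by omega)
        rw [rTensor_proj_rightOp, LinearMap.rTensor_tmul, proj_of_mem hy, if_pos rfl] at h
        rwa [show m + (i + 0) - i = m by omega] at h
      rw [rTensor_proj_rightOp, LinearMap.rTensor_tmul, proj_of_mem hy, if_pos rfl,
        rightOp_tmul b p x y z, Nat.add_sub_cancel_left]
      simp only [LinearEquiv.coe_coe, TensorProduct.assoc_symm_tmul, LinearMap.rTensor_tmul,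
        tauHat_tmul]
      rw [hi]
      generalize rightOp b p x (y ⊗ₜ 1) = Z
      induction Z with
      | zero => simp
      | add x y hx hy => simp only [TensorProduct.add_tmul, map_add, smul_add, hx, hy]
      | tmul c d =>
        simp only [TensorProduct.map_tmul, TensorProduct.assoc_tmul, LinearMap.lTensor_tmul,
          lambdaR_of_mem b p t (proj_mem m d) hz, phi_eq_deg, deg_of_mem _ (proj_mem i c),
          LinearMap.mulRight_apply, TensorProduct.tmul_smul, ← TensorProduct.smul_tmul', smul_smul]
        rw [mul_comm]
    · intro k _ hk
      rw [rTensor_proj_rightOp, LinearMap.rTensor_tmul, proj_of_mem hy, if_neg hk.symm]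
      simp
    · intro h
      exact absurd (Finset.mem_range.2 (by omega)) h

/-! The braiding expressed through product, coproduct and antipode. -/

/-- The braiding is left visible on the right so that this term cancels against the one produced by
sliding `v` past `S x` in `unwind_coprod`. -/
theorem deg_gauss_ι_mul (b : Module.Basis ι F V) (p : F) (v : V) (x : Λ) :
    deg (gauss p) (ExteriorAlgebra.ι F v * x) =
      -mulR (LinearMap.rTensor V (deg (gauss p)) (crossAux b p x v)) := by
  have h' : (fun k => gauss p (k + 1)) = fun k => (-1) * (p ^ k * gauss p k) := by
    funext k
    rw [gauss_succ]
    ring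
  rw [← crossAux_deg, mulR_crossAux, phi_eq_deg, deg_deg, deg_ι_mul, h', smul_deg]
  simp

/-- The map `x ⊗ y ↦ (S x ⊗ 1) · Δ y · Y`. -/
def unwind (b : Module.Basis ι F V) (p : F) (Y : Λ ⊗[F] Λ) : Λ ⊗[F] Λ →ₗ[F] Λ ⊗[F] Λ :=
  TensorProduct.lift ((leftMul ∘ₗ deg (gauss p)).compl₂
    (LinearMap.applyₗ Y ∘ₗ (comulOp b p).toLinearMap))

theorem unwind_tmul (b : Module.Basis ι F V) (p : F) (Y : Λ ⊗[F] Λ) (x y : Λ) :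
    unwind b p Y (x ⊗ₜ y) = leftMul (deg (gauss p) x) (comulOp b p y Y) := by
  simp [unwind]

/-- Write `τ̂(v ⊗ x) = ∑ x' ⊗ v'`. The first term is `-∑ (S x' ⊗ 1)(v' ⊗ 1) Δ z · Y`, and it cancels
the part `v' ⊗ 1` of `Δ v'` in the second. What is left, `∑ (S x' ⊗ 1)(1 ⊗ v') Δ z · Y`, is `1 ⊗ v`
moved past `S x ⊗ 1`. -/
theorem unwind_coprod (b : Module.Basis ι F V) (p : F) (Y : Λ ⊗[F] Λ) (v : V) (X : Λ ⊗[F] Λ) :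
    unwind b p Y (mulLeft v X) + unwind b p Y (mulRight b p v X) =
      mulRight b p v (unwind b p Y X) := by
  induction X with
  | zero => simp
  | add x z hx hz =>
    simp only [map_add]
    rw [add_add_add_comm, hx, hz]
  | tmul x z =>
    rw [mulLeft_tmul, unwind_tmul, unwind_tmul, mulRight_leftMul, crossAux_deg,
      deg_gauss_ι_mul b, mulRight_tmul]
    generalize crossAux b p x v = X
    induction X with
    | zero => simp
    | add x y hx hy =>
      simp only [map_add, TensorProduct.add_tmul, neg_add, LinearMap.add_apply] at hx hy ⊢
      rw [add_add_add_comm, hx, hy]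
    | tmul a c =>
      simp only [LinearMap.rTensor_tmul, mulR_tmul, TensorProduct.assoc_tmul,
        LinearMap.lTensor_tmul, mulL_tmul, unwind_tmul, slide_tmul, map_neg, LinearMap.neg_apply,
        leftMul_mul_ι, comulOp_ι_mul, LinearMap.add_apply, Module.End.mul_apply, map_add]
      abel

/-- This is `1 ⊗ x = ∑ (S x₁ ⊗ 1) Δ x₂`, as operators applied to `Y`. It trades the braiding of `x`
for product, coproduct and antipode. -/
theorem rightOp_eq_unwind (b : Module.Basis ι F V) (p : F) (Y : Λ ⊗[F] Λ) (x : Λ) :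
    rightOp b p x Y = unwind b p Y (comul b p x) := by
  refine ext_left (κ := Unit)
    (f := fun _ => LinearMap.applyₗ Y ∘ₗ (rightOp b p).toLinearMap)
    (g := fun _ => unwind b p Y ∘ₗ comul b p) ?_ ?_ () x
  · intro _
    simp [comul_one, unwind_tmul, deg_one, gauss_zero, leftMul_one]
  · intro x hx _ v
    have := hx ()
    simp only [LinearMap.comp_apply, LinearMap.applyₗ_apply_apply, AlgHom.toLinearMap_apply]
      at this ⊢
    rw [rightOp_ι_mul, Module.End.mul_apply, this, comul_ι_mul, map_add, unwind_coprod]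

/-! The operators `L_k` and `R_k`. -/

theorem rungL_tmul (b : Module.Basis ι F V) (p : F) (k : ℕ) (x y : Λ) :
    rungL b p k (x ⊗ₜ y) = leftMul x (LinearMap.rTensor Λ (proj k) (comul b p y)) := by
  simp only [rungL, splitRight, comulL, LinearMap.comp_apply, LinearMap.lTensor_tmul]
  generalize LinearMap.rTensor Λ (proj k) (comul b p y) = Y
  induction Y with
  | zero => simp
  | add x y hx hy => simp only [TensorProduct.tmul_add, map_add, hx, hy]
  | tmul y z => simp [nabla, leftMul_tmul]

theorem rungR_tmul (b : Module.Basis ι F V) (p : F) (k : ℕ) (x y : Λ) :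
    rungR b p k (x ⊗ₜ y) = LinearMap.lTensor Λ (LinearMap.mulRight F y)
      (LinearMap.lTensor Λ (proj k) (comul b p x)) := by
  simp only [rungR, splitLeft, comulR, LinearMap.comp_apply, LinearMap.rTensor_tmul]
  generalize LinearMap.lTensor Λ (proj k) (comul b p x) = Y
  induction Y with
  | zero => simp
  | add x y hx hy => simp only [TensorProduct.add_tmul, map_add, hx, hy]
  | tmul y z => simp [nabla]

theorem rTensor_proj_leftMul {r : ℕ} {x : Λ} (hx : x ∈ ⋀[F]^r V) (i : ℕ) (X : Λ ⊗[F] Λ) :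
    LinearMap.rTensor Λ (proj i) (leftMul x X) =
      if r ≤ i then leftMul x (LinearMap.rTensor Λ (proj (i - r)) X) else 0 := by
  induction X with
  | zero => simp
  | add x y hx hy =>
    rw [map_add, map_add, map_add, map_add, hx, hy]
    split_ifs <;> simp
  | tmul y z =>
    rw [leftMul_tmul, LinearMap.rTensor_tmul, LinearMap.rTensor_tmul, leftMul_tmul, proj, proj,
      GradedAlgebra.proj_apply, GradedAlgebra.proj_apply]
    split_ifs with h
    · rw [DirectSum.coe_decompose_mul_of_left_mem_of_le (fun i : ℕ => ⋀[F]^i V) hx h]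
    · rw [DirectSum.coe_decompose_mul_of_left_mem_of_not_le (fun i : ℕ => ⋀[F]^i V) hx h,
        TensorProduct.zero_tmul]

/-- The components of the braiding in terms of the operators `L_k` and `R_k`. -/
theorem rTensor_proj_rightOp_comul (b : Module.Basis ι F V) (p : F) (i : ℕ) {m : ℕ} {x : Λ}
    (hx : x ∈ ⋀[F]^m V) (y : Λ) :
    LinearMap.rTensor Λ (proj i) (rightOp b p x (comul b p y)) =
      ∑ k ∈ Finset.range (min i m + 1),
        gauss p k • rungL b p (i - k) (rungR b p (m - k) (x ⊗ₜ y)) := by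
  simp only [rungR_tmul]
  rw [rightOp_eq_unwind]
  refine totalDeg_induction (P := fun X => LinearMap.rTensor Λ (proj i)
    (unwind b p (comul b p y) X) = ∑ k ∈ Finset.range (min i m + 1), gauss p k •
      rungL b p (i - k) (LinearMap.lTensor Λ (LinearMap.mulRight F y)
        (LinearMap.lTensor Λ (proj (m - k)) X))) ?_ ?_ ?_ (comul_mem_totalDeg b p hx)
  · simp
  · intro X Y hX hY
    simp only [map_add, smul_add, Finset.sum_add_distrib, hX, hY]
  · rintro r s rfl x hx z hz
    rw [unwind_tmul, deg_of_mem _ hx, map_smul, LinearMap.smul_apply, map_smul,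
      rTensor_proj_leftMul hx, ← comul_mul]
    -- Here `z` has degree `s`, so only `k = r` passes the projection. The bound on `k` keeps the
    -- truncated subtraction faithful.
    have hk : ∀ k ≤ r + s, k ≠ r → proj (r + s - k) z = 0 := fun k h h' => by
      rw [proj_of_mem hz, if_neg (by omega)]
    split_ifs with h
    · rw [Finset.sum_eq_single r]
      · rw [LinearMap.lTensor_tmul, LinearMap.lTensor_tmul, rungL_tmul, Nat.add_sub_cancel_left,
          proj_of_mem hz, if_pos rfl, LinearMap.mulRight_apply]
      · intro k hk' hk''
        rw [LinearMap.lTensor_tmul, hk k (by have := Finset.mem_range.1 hk'; omega) hk'']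
        simp
      · intro h'
        exact absurd (Finset.mem_range.2 (by omega)) h'
    -- If `r > i`, the left factor already exceeds degree `i`, and no index `k ≤ i` can equal `r`.
    · rw [smul_zero, Finset.sum_eq_zero]
      intro k hk'
      have := Finset.mem_range.1 hk'
      rw [LinearMap.lTensor_tmul, hk k (by omega) (by omega)]
      simp

/-! The divided powers of `L` and `R`. -/

theorem qInt_succ (q : F) (n : ℕ) : qInt q (n + 1) = qInt q n + q ^ n :=
  Finset.sum_range_succ _ _

theorem qInt_succ' (q : F) (n : ℕ) : qInt q (n + 1) = q * qInt q n + 1 := by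
  rw [qInt, qInt, Finset.sum_range_succ', Finset.mul_sum, pow_zero]
  simp only [pow_succ']

theorem qFact_succ (q : F) (n : ℕ) : qFact q (n + 1) = qFact q n * qInt q (n + 1) :=
  Finset.prod_Icc_succ_top (by omega) _

theorem qFact_ne_zero {q : F} {n : ℕ} (h : ∀ j, 1 ≤ j → j ≤ n → qInt q j ≠ 0) : qFact q n ≠ 0 :=
  Finset.prod_ne_zero_iff.2 fun j hj => h j (Finset.mem_Icc.1 hj).1 (Finset.mem_Icc.1 hj).2

theorem divPow_eq_of_pow_eq {A : Type*} [Ring A] [Algebra F A] {q : F} {x y : A} {n : ℕ}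
    (h : x ^ n = qFact q n • y) (hn : qFact q n ≠ 0) : divPow q x n = y := by
  rw [divPow, h, smul_smul, inv_mul_cancel₀ hn, one_smul]

theorem divPow_smul {A : Type*} [Ring A] [Algebra F A] (q t : F) (x : A) (n : ℕ) :
    divPow q (t • x) n = t ^ n • divPow q x n := by
  rw [divPow, divPow, smul_pow, smul_comm]

theorem pow_eq_qFact_smul {A : Type*} [Ring A] [Algebra F A] {q : F} {x : A} {y : ℕ → A}
    (h0 : y 0 = 1) (h : ∀ n, x * y n = qInt q (n + 1) • y (n + 1)) (n : ℕ) :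
    x ^ n = qFact q n • y n := by
  induction n with
  | zero => simp [h0, qFact]
  | succ n ih => rw [pow_succ', ih, mul_smul_comm, h, smul_smul, qFact_succ]

theorem rungL_zero (b : Module.Basis ι F V) (p : F) : rungL b p 0 = 1 :=
  TensorProduct.ext' fun x y => by
    rw [rungL_tmul, rTensor_proj_zero_comul, leftMul_tmul, mul_one, Module.End.one_apply]

theorem rungR_zero (b : Module.Basis ι F V) (p : F) : rungR b p 0 = 1 :=
  TensorProduct.ext' fun x y => by
    rw [rungR_tmul, lTensor_proj_zero_comul]
    simp

theorem rungL_leftMul (b : Module.Basis ι F V) (p : F) (k : ℕ) (a : Λ) (X : Λ ⊗[F] Λ) :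
    rungL b p k (leftMul a X) = leftMul a (rungL b p k X) := by
  induction X with
  | zero => simp
  | add x y hx hy => simp only [map_add, hx, hy]
  | tmul x y =>
    rw [leftMul_tmul, rungL_tmul, rungL_tmul]
    generalize LinearMap.rTensor Λ (proj k) (comul b p y) = Y
    induction Y with
    | zero => simp
    | add x y hx hy => simp only [map_add, hx, hy]
    | tmul y z => simp only [leftMul_tmul, mul_assoc]

theorem rungL_mulLeft (b : Module.Basis ι F V) (p : F) (k : ℕ) (v : V) (X : Λ ⊗[F] Λ) :
    rungL b p k (mulLeft v X) = mulLeft v (rungL b p k X) := by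
  have h : mulLeft v = leftMul (ExteriorAlgebra.ι F v) := by
    rw [← mul_one (ExteriorAlgebra.ι F v), leftMul_ι_mul, leftMul_one, mul_one]
  rw [h, rungL_leftMul]

theorem rungR_lTensor_mulRight (b : Module.Basis ι F V) (p : F) (k : ℕ) (a : Λ) (X : Λ ⊗[F] Λ) :
    rungR b p k (LinearMap.lTensor Λ (LinearMap.mulRight F a) X) =
      LinearMap.lTensor Λ (LinearMap.mulRight F a) (rungR b p k X) := by
  induction X with
  | zero => simp
  | add x y hx hy => simp only [map_add, hx, hy]
  | tmul x y =>
    rw [LinearMap.lTensor_tmul, rungR_tmul, rungR_tmul]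
    generalize LinearMap.lTensor Λ (proj k) (comul b p x) = Y
    induction Y with
    | zero => simp
    | add x y hx hy => simp only [map_add, hx, hy]
    | tmul y z => simp [mul_assoc]

/-- `L` either extracts a vector from behind the outgoing strand or extracts that strand itself. In
the second case the strand is multiplied into the left factor it has just crossed, giving `∇ τ̂(v ⊗
x) = v φ_p(x)`. -/
theorem opL_mulRight (b : Module.Basis ι F V) (p : F) (v : V) (X : Λ ⊗[F] Λ) :
    opL b p (mulRight b p v X) =
      mulRight b p v (opL b p X) + mulLeft v (LinearMap.rTensor Λ (phi p) X) := by
  induction X with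
  | zero => simp
  | add x y hx hy => simp only [map_add, hx, hy, add_add_add_comm]
  | tmul x y =>
    have h : ∀ X : Λ ⊗[F] V, opL b p (LinearMap.lTensor Λ mulL
        (TensorProduct.assoc F Λ V Λ (X ⊗ₜ y))) =
        slide b p X (LinearMap.rTensor Λ (proj 1) (comul b p y)) + mulR X ⊗ₜ y := by
      intro X
      induction X with
      | zero => simp
      | add x y hx hy =>
        simp only [TensorProduct.add_tmul, map_add, LinearMap.add_apply, hx, hy,
          add_add_add_comm]
      | tmul a c =>
        rw [TensorProduct.assoc_tmul, LinearMap.lTensor_tmul, mulL_tmul, opL, rungL_tmul,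
          comul_ι_mul, map_add, rTensor_proj_succ_mulLeft, rTensor_proj_mulRight,
          rTensor_proj_zero_comul, mulLeft_tmul, map_add, leftMul_tmul, slide_tmul, mulR_tmul,
          mul_one, add_comm, Module.End.mul_apply]
    rw [mulRight_tmul, h, ← mulRight_leftMul, mulR_crossAux, opL, rungL_tmul,
      LinearMap.rTensor_tmul, mulLeft_tmul]

theorem rTensor_phi_proj (p : F) (j : ℕ) (X : Λ ⊗[F] Λ) :
    LinearMap.rTensor Λ (phi p) (LinearMap.rTensor Λ (proj j) X) =
      p ^ j • LinearMap.rTensor Λ (proj j) X := by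
  induction X with
  | zero => simp
  | add x y hx hy => simp only [map_add, smul_add, hx, hy]
  | tmul x y => simp [phi_eq_deg, deg_of_mem _ (proj_mem j x), TensorProduct.smul_tmul']

/-- Induction on the word. The terms in `v ⊗ 1` have coefficients `[j]_p` and `p^j`, the latter from
`φ_p` on left degree `j`; they add up to `[j+1]_p`. -/
theorem opL_comul (b : Module.Basis ι F V) (p : F) (j : ℕ) (y : Λ) :
    opL b p (LinearMap.rTensor Λ (proj j) (comul b p y)) =
      qInt p (j + 1) • LinearMap.rTensor Λ (proj (j + 1)) (comul b p y) := by
  refine ext_left (κ := ℕ) (f := fun j => opL b p ∘ₗ LinearMap.rTensor Λ (proj j) ∘ₗ comul b p)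
    (g := fun j => qInt p (j + 1) • (LinearMap.rTensor Λ (proj (j + 1)) ∘ₗ comul b p)) ?_ ?_ j y
  · intro j
    simp [comul_one, opL, rungL_tmul, proj_of_mem one_mem_zero]
  · intro y hy j v
    simp only [LinearMap.comp_apply, LinearMap.smul_apply] at hy ⊢
    rw [comul_ι_mul, map_add, map_add, map_add, rTensor_proj_succ_mulLeft, rTensor_proj_mulRight,
      rTensor_proj_mulRight, opL_mulRight, hy, rTensor_phi_proj]
    cases j with
    | zero =>
      rw [rTensor_proj_zero_mulLeft]
      simp only [map_zero, map_smul, zero_add, qInt_succ p 0, show qInt p 0 = 0 from rfl, pow_zero]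
      module
    | succ j =>
      rw [rTensor_proj_succ_mulLeft, opL, rungL_mulLeft, ← opL, hy, map_smul, map_smul, map_smul,
        qInt_succ p (j + 1)]
      module

theorem opL_mul_rungL (b : Module.Basis ι F V) (p : F) (j : ℕ) :
    opL b p * rungL b p j = qInt p (j + 1) • rungL b p (j + 1) :=
  TensorProduct.ext' fun x y => by
    rw [Module.End.mul_apply, LinearMap.smul_apply, rungL_tmul, rungL_tmul, opL, rungL_leftMul,
      ← opL, opL_comul, map_smul]

theorem opR_mulLeft (b : Module.Basis ι F V) (p : F) (v : V) (X : Λ ⊗[F] Λ) :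
    opR b p (mulLeft v X) = mulLeft v (opR b p X) + mulRight b p v X := by
  induction X with
  | zero => simp
  | add x y hx hy => simp only [map_add, hx, hy, add_add_add_comm]
  | tmul x y =>
    rw [mulLeft_tmul, opR, rungR_tmul, comul_ι_mul, map_add, map_add, lTensor_mulLeft,
      lTensor_mulLeft, lTensor_proj_succ_mulRight, lTensor_proj_zero_comul, rungR_tmul,
      ← mulRight_lTensor_mulRight]
    simp

theorem opR_one_tmul (b : Module.Basis ι F V) (p : F) (y : Λ) : opR b p (1 ⊗ₜ y) = 0 := by
  simp [opR, rungR_tmul, comul_one, proj_of_mem one_mem_zero]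

/-- Induction on the left factor of `X`; the base case is that `R` kills `1 ⊗ y`. For a new letter
`w`, the braided relation moves `v` past `w`, and the extra term of `opR_mulLeft` is a product of
two vectors on the right strand, where `τ` acts as `p`. -/
theorem opR_mulRight (b : Module.Basis ι F V) (p : F) (v : V) (X : Λ ⊗[F] Λ) :
    opR b p (mulRight b p v X) = p • mulRight b p v (opR b p X) := by
  induction X with
  | zero => simp
  | add x y hx hy => simp only [map_add, smul_add, hx, hy]
  | tmul x z =>
    refine ext_left (κ := V)
      (f := fun v => opR b p ∘ₗ mulRight b p v ∘ₗ (TensorProduct.mk F Λ Λ).flip z)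
      (g := fun v => p • (mulRight b p v ∘ₗ opR b p ∘ₗ (TensorProduct.mk F Λ Λ).flip z))
      ?_ ?_ v x
    · intro v
      simp [mulRight_one_tmul, opR_one_tmul]
    · intro x hx v w
      simp only [LinearMap.comp_apply, LinearMap.smul_apply, LinearMap.flip_apply,
        TensorProduct.mk_apply, ← mulLeft_tmul] at hx ⊢
      generalize x ⊗ₜ[F] z = A at hx ⊢
      have h : ∀ Y : V ⊗[F] V, opR b p ((LinearMap.mul' F _ ∘ₗ
          TensorProduct.map mulLeft (mulRight b p)) Y A) =
          p • (LinearMap.mul' F _ ∘ₗ TensorProduct.map mulLeft (mulRight b p)) Y (opR b p A) +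
          (LinearMap.mul' F _ ∘ₗ TensorProduct.map (mulRight b p) (mulRight b p)) Y A := by
        intro Y
        induction Y with
        | zero => simp
        | add x y hx hy =>
          simp only [map_add, LinearMap.add_apply, hx, hy, smul_add]
          abel
        | tmul c d => simp [opR_mulLeft, hx]
      have h' := LinearMap.congr_fun (mulRight_mul_mulLeft b p v w)
      simp only [Module.End.mul_apply] at h'
      rw [h', h, ← h', mulRight_tau, opR_mulLeft, map_add, smul_add]
      simp

/-- As for `L`, but the coefficients now meet on the terms in `1 ⊗ v`, as `p [j]_p + 1 = [j+1]_p`.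
-/
theorem opR_comul (b : Module.Basis ι F V) (p : F) (j : ℕ) (x : Λ) :
    opR b p (LinearMap.lTensor Λ (proj j) (comul b p x)) =
      qInt p (j + 1) • LinearMap.lTensor Λ (proj (j + 1)) (comul b p x) := by
  refine ext_left (κ := ℕ) (f := fun j => opR b p ∘ₗ LinearMap.lTensor Λ (proj j) ∘ₗ comul b p)
    (g := fun j => qInt p (j + 1) • (LinearMap.lTensor Λ (proj (j + 1)) ∘ₗ comul b p)) ?_ ?_ j x
  · intro j
    simp [comul_one, opR_one_tmul, proj_of_mem one_mem_zero]
  · intro x hx j v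
    simp only [LinearMap.comp_apply, LinearMap.smul_apply] at hx ⊢
    rw [comul_ι_mul, map_add, map_add, map_add, lTensor_mulLeft, lTensor_mulLeft,
      lTensor_proj_succ_mulRight, opR_mulLeft, hx]
    cases j with
    | zero =>
      rw [lTensor_proj_zero_mulRight]
      simp only [map_zero, map_smul, qInt_succ p 0, show qInt p 0 = 0 from rfl, pow_zero]
      module
    | succ j =>
      rw [lTensor_proj_succ_mulRight, opR_mulRight, hx, map_smul, map_smul, qInt_succ' p (j + 1)]
      module

theorem opR_mul_rungR (b : Module.Basis ι F V) (p : F) (j : ℕ) :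
    opR b p * rungR b p j = qInt p (j + 1) • rungR b p (j + 1) :=
  TensorProduct.ext' fun x y => by
    rw [Module.End.mul_apply, LinearMap.smul_apply, rungR_tmul, rungR_tmul, opR,
      rungR_lTensor_mulRight, ← opR, opR_comul, map_smul]

theorem divPow_opL (b : Module.Basis ι F V) {p : F} {n : ℕ}
    (h : ∀ j, 1 ≤ j → j ≤ n → qInt p j ≠ 0) : divPow p (opL b p) n = rungL b p n :=
  divPow_eq_of_pow_eq (pow_eq_qFact_smul (rungL_zero b p) (opL_mul_rungL b p) n) (qFact_ne_zero h)

theorem divPow_opR (b : Module.Basis ι F V) {p : F} {n : ℕ}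
    (h : ∀ j, 1 ≤ j → j ≤ n → qInt p j ≠ 0) : divPow p (opR b p) n = rungR b p n :=
  divPow_eq_of_pow_eq (pow_eq_qFact_smul (rungR_zero b p) (opR_mul_rungR b p) n) (qFact_ne_zero h)

/-! The formulas for the `R`-matrix. -/

theorem f_mem (b : Module.Basis ι F V) (E : Finset ι) : f b E ∈ ⋀[F]^E.card V := by
  rw [← E.length_sort (· ≤ ·), f]
  generalize E.sort (· ≤ ·) = l
  induction l with
  | nil => exact one_mem_zero
  | cons i l ih =>
    rw [List.map_cons, List.prod_cons, List.length_cons]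
    exact ι_mul_mem ih (b i)

theorem map_proj_rTensor_proj (i j k : ℕ) (X : Λ ⊗[F] Λ) :
    TensorProduct.map (proj i) (proj j) (LinearMap.rTensor Λ (proj k) X) =
      if k = i then TensorProduct.map (proj i) (proj j) (LinearMap.rTensor Λ (proj i) X) else 0 := by
  split_ifs with h
  · rw [h]
  · induction X with
    | zero => simp
    | add x y hx hy => simp only [map_add, hx, hy, add_zero]
    | tmul x y => simp [proj_proj, h]

theorem map_proj_of_totalDeg {n : ℕ} {X : Λ ⊗[F] Λ} (hX : X ∈ totalDeg F V n) {i j : ℕ}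
    (h : i + j ≠ n) :
    TensorProduct.map (proj i) (proj j) (LinearMap.rTensor Λ (proj i) X) = 0 := by
  refine totalDeg_induction (P := fun X =>
    TensorProduct.map (proj i) (proj j) (LinearMap.rTensor Λ (proj i) X) = 0) (by simp)
    (fun X Y hX hY => by rw [map_add, map_add, hX, hY, add_zero]) ?_ hX
  rintro k l rfl x hx y hy
  rw [LinearMap.rTensor_tmul, TensorProduct.map_tmul, proj_of_mem hx, proj_of_mem hy]
  split_ifs with h1 h2
  · omega
  all_goals simp

theorem rho_f (b : Module.Basis ι F V) (p t : F) (E G : Finset ι)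
    (h : ∀ j : ℕ, 1 ≤ j → j ≤ max E.card G.card → qInt p j ≠ 0) :
    rho b p t (f b E ⊗ₜ f b G) = ∑ k ∈ Finset.range (min E.card G.card + 1),
      (t ^ k * gauss p k) • W (G.card - k) (t * p ^ E.card) (t • opL b p) p
        (divPow p (opR b p) (E.card - k) (f b E ⊗ₜ f b G)) := by
  rw [rho_of_mem b p t (f_mem b E) (f_mem b G)]
  simp only [rTensor_proj_rightOp_comul b p _ (f_mem b E), Finset.smul_sum, smul_smul]
  generalize f b E ⊗ₜ[F] f b G = X
  generalize E.card = m at h ⊢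
  generalize G.card = n at h ⊢
  -- The pairs are those with `k ≤ i ≤ n` and `k ≤ m`. For fixed `k`, the substitution `i = k + j`
  -- splits `t^i` as `t^k t^j`, and `t^j` is absorbed by the divided powers of `t L`.
  rw [Finset.sum_comm' (s' := fun k => Finset.Ico k (n + 1)) (t' := Finset.range (min m n + 1))
    (fun i k => by simp only [Finset.mem_range, Finset.mem_Ico]; omega)]
  refine Finset.sum_congr rfl fun k hk => ?_
  have hk' := Finset.mem_range.1 hk
  rw [Finset.sum_Ico_eq_sum_range, W, LinearMap.sum_apply, Finset.smul_sum,
    show n + 1 - k = n - k + 1 by omega]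
  refine Finset.sum_congr rfl fun j hj => ?_
  have hj' := Finset.mem_range.1 hj
  rw [divPow_smul, divPow_opL b fun i h1 h2 => h i h1 (by omega),
    divPow_opR b fun i h1 h2 => h i h1 (by omega), LinearMap.smul_apply, LinearMap.smul_apply,
    smul_smul, smul_smul, Nat.add_sub_cancel_left, Nat.sub_add_eq]
  congr 1
  ring

theorem rho_component (b : Module.Basis ι F V) (p t : F) {m n i : ℕ} (hi : i ≤ n) :
    TensorProduct.map (proj i) (proj (m + n - i)) ∘ₗ rho b p t ∘ₗ
        TensorProduct.map (proj m) (proj n) =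
      (t ^ i * qPoch (t * p ^ m) p (n - i)) • ∑ k ∈ Finset.range (min i m + 1), gauss p k •
        (TensorProduct.map (proj i) (proj (m + n - i)) ∘ₗ rungL b p (i - k) ∘ₗ
          rungR b p (m - k) ∘ₗ TensorProduct.map (proj m) (proj n)) := by
  refine TensorProduct.ext' fun x y => ?_
  simp only [LinearMap.comp_apply, LinearMap.smul_apply, LinearMap.sum_apply,
    TensorProduct.map_tmul]
  rw [rho_of_mem b p t (proj_mem m x) (proj_mem n y), map_sum, Finset.sum_eq_single i]
  · rw [map_smul, rTensor_proj_rightOp_comul b p i (proj_mem m x), map_sum]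
    simp only [map_smul]
  · intro k _ hk
    rw [map_smul, map_proj_rTensor_proj, if_neg hk, smul_zero]
  · intro h
    exact absurd (Finset.mem_range.2 (by omega)) h

theorem rho_component_eq_zero (b : Module.Basis ι F V) (p t : F) {m n i j : ℕ}
    (h : n < i ∨ i + j ≠ m + n) :
    TensorProduct.map (proj i) (proj j) ∘ₗ rho b p t ∘ₗ
        TensorProduct.map (proj m) (proj n) = 0 := by
  refine TensorProduct.ext' fun x y => ?_
  simp only [LinearMap.comp_apply, TensorProduct.map_tmul, LinearMap.zero_apply]
  rw [rho_of_mem b p t (proj_mem m x) (proj_mem n y), map_sum]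
  refine Finset.sum_eq_zero fun k hk => ?_
  have hk' := Finset.mem_range.1 hk
  rw [map_smul, map_proj_rTensor_proj]
  split_ifs with hki
  -- A surviving index equals `i` and is at most `n`, so only `i + j ≠ m + n` is possible, and
  -- conservation of total degree applies.
  · rw [map_proj_of_totalDeg (rightOp_mem_totalDeg b p (proj_mem m x)
      (comul_mem_totalDeg b p (proj_mem n y))) (by omega), smul_zero]
  · rw [smul_zero]

end LambdaP
end

theorem mainTheorem4 {K V ι : Type*} [Field K] [AddCommGroup V] [Module K V] [LinearOrder ι]
    (b : Module.Basis ι K V) (p t : K) (hp : p ≠ 0) (ht : t ≠ 0) :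
    (∀ E F : Finset ι, (∀ j : ℕ, 1 ≤ j → j ≤ max E.card F.card → LambdaP.qInt p j ≠ 0) →
      LambdaP.rho b p t (TensorProduct.tmul K (LambdaP.f b E) (LambdaP.f b F)) =
        ∑ k ∈ Finset.range (min E.card F.card + 1),
          (t ^ k * LambdaP.gauss p k) •
            LambdaP.W (F.card - k) (t * p ^ E.card) (t • LambdaP.opL b p) p
              (LambdaP.divPow p (LambdaP.opR b p) (E.card - k)
                (TensorProduct.tmul K (LambdaP.f b E) (LambdaP.f b F)))) ∧
    (∀ m n i : ℕ, i ≤ n →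
      TensorProduct.map (LambdaP.proj i) (LambdaP.proj (m + n - i)) ∘ₗ LambdaP.rho b p t ∘ₗ
          TensorProduct.map (LambdaP.proj m) (LambdaP.proj n) =
        (t ^ i * LambdaP.qPoch (t * p ^ m) p (n - i)) •
          ∑ k ∈ Finset.range (min i m + 1),
            LambdaP.gauss p k •
              (TensorProduct.map (LambdaP.proj i) (LambdaP.proj (m + n - i)) ∘ₗ
                LambdaP.rungL b p (i - k) ∘ₗ LambdaP.rungR b p (m - k) ∘ₗ
                  TensorProduct.map (LambdaP.proj m) (LambdaP.proj n))) ∧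
    (∀ m n i j : ℕ, (n < i ∨ i + j ≠ m + n) →
      TensorProduct.map (LambdaP.proj i) (LambdaP.proj j) ∘ₗ LambdaP.rho b p t ∘ₗ
          TensorProduct.map (LambdaP.proj m) (LambdaP.proj n) = 0) := by
  exact ⟨LambdaP.rho_f b p t, fun _ _ _ hi => LambdaP.rho_component b p t hi,
    fun _ _ _ _ h => LambdaP.rho_component_eq_zero b p t h⟩
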